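/- Let $S_g$ denote a closed connected oriented smooth surface. An oriented knot in $S_g\times S^1$ is a smooth embedding $K:S^1\to S_g\times S^1$. Its degree $\deg K\in\mathbb Z$ is the degree of its projection $S^1\to S^1$ to the second factor. Two knots $K\subset S_g\times S^1$ and $K'\subset S_{g'}\times S^1$ are equivalent if they are related by a finite sequence of smooth isotopies, admissible diffeomorphisms, destabilizations, and inverses of these. Here a destabilization cuts $S_g\times S^1$ along a torus $C\times S^1$ disjoint from the knot, $C\subset S_g$ a non-contractible smooth simple closed curve, keeps the piece containing the knot, and glues a copy of $D^2\times S^1$ to each new boundary torus. The admissible diffeomorphisms may be taken to be either (a) all diffeomorphisms $S_g\times S^1\to S_{g'}\times S^1$ that preserve the projection to $S^1$ up to homotopy, or (b) only the products $F\times\mathrm{id}$ with $F:S_g\to S_{g'}$ an orientation preserving diffeomorphism, in which case the gluings in destabilizations are also to respect the orientations of the surfaces. The result below holds for each of these two notions of equivalence. An oriented diagram $D$ on $S_g$ is a generic immersed closed oriented curve with over/under information at its double points and finitely many vertices away from the double points, each marked "up" or "down". It is a diagram of $K$ if the curve is the projection of $K$, the vertices are the points where $K$ crosses the level $S_g\times\{1\}$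 (transversally, in the positive direction of $S^1$ at "up" vertices and in the negative direction at "down" vertices), and at each double point the over-strand is the one that is higher after cutting $S^1$ open at $1$ to $[0,1]$. Two diagrams are equivalent if they are diagrams of equivalent knots. The degree of $D$ is the number of "up" vertices minus the number of "down" vertices. Let $D$ have degree $k\neq0$. Fix a point $b$ on $D$, and label the arcs of $D$ by integers so that the label is $0$ at $b$, and, walking along the diagram from $b$, it increases by $1$ at each "up" vertex and decreases by $1$ at each "down" vertex. Put each arc on the layer in $\{0,\dots,|k|-1\}$ given by its label modulo $|k|$. The lifted diagram $\hat D$ has the same curve; at a double point of strands on different layers, the strand on the higher layer is the over-strand, and strands on the same layer cross as in $D$; of the vertices one keeps only the "up" vertices from layer $|k|-1$ to layer $0$ and the "down" vertices from layer $0$ to layer $|k|-1$. Let $D$ and $D'$ be equivalent oriented diagrams on $S_g$ and $S_{g'}$, where $D$ has degree $k\ne0$. Then: 1. $D'$ also has degree $k$, and every knot with diagram $D$ or $D'$ has degree $k$. 2. Let $m\in\{k,-k\}$ and let $p_m(x,z)=(x,z^m)$ be the corresponding $|k|$-fold covering of $S_g\times S^1$ (respectively $S_{g'}\times S^1$) by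 itself. Every knot $K$ with diagram $D$ and every knot $K'$ with diagram $D'$ lift along $p_m$ to knots in $S_g\times S^1$ and $S_{g'}\times S^1$. There is $d\in\{1,-1\}$ such that, for all such $K,K'$, any lift $\hat K$ of $K$ and any lift $\hat K'$ of $K'$ are equivalent knots of degree $d$. 3. For all choices of the fixed points $b$ on $D$ and $b'$ on $D'$: every knot with diagram $D$ (respectively $D'$) has a lift along $p_{|k|}$ with diagram $\hat D$ (respectively $\hat D'$); the diagrams $\hat D$ and $\hat D'$ are equivalent; and there is $d\in\{1,-1\}$ such that any knot with diagram $\hat D$ and any knot with diagram $\hat D'$ are equivalent knots of degree $d$. -/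

import Mathlib

open scoped Manifold ContDiff

universe u

/-- The plane on which surfaces are modelled. -/
abbrev Plane : Type := EuclideanSpace ℝ (Fin 2)

/-- A closed (compact, without boundary), connected, oriented smooth surface. The orientation is
carried by the atlas: all changes of charts have positive Jacobian determinant. By the
classification of surfaces these are the surfaces `S_g`, `g ≥ 0`. -/
structure ClosedSurface : Type (u + 1) where
  carrier : Type u
  [topology : TopologicalSpace carrier]
  [hausdorff : T2Space carrier]
  [compact : CompactSpace carrier]
  [connected : ConnectedSpace carrier]
  [charted : ChartedSpace Plane carrier]
  [smooth : IsManifold (𝓡 2) ∞ carrier]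
  oriented : ∀ e ∈ atlas Plane carrier, ∀ e' ∈ atlas Plane carrier,
    ∀ x ∈ (e.symm.trans e').source, 0 < (fderiv ℝ (e.symm.trans e') x).det

instance : CoeSort ClosedSurface.{u} (Type u) := ⟨ClosedSurface.carrier⟩

attribute [instance] ClosedSurface.topology ClosedSurface.hausdorff ClosedSurface.compact
  ClosedSurface.connected ClosedSurface.charted ClosedSurface.smooth

/-- The model with corners of the `3`-manifold `S × S¹`. -/
noncomputable abbrev model3 :
    ModelWithCorners ℝ (Plane × EuclideanSpace ℝ (Fin 1))
      (ModelProd Plane (EuclideanSpace ℝ (Fin 1))) :=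
  (𝓡 2).prod (𝓡 1)

/-! ### Knots in `S × S¹` and their degree -/

/-- An oriented knot in `S × S¹`: a smooth embedding of the circle, that is (the circle being
compact) an injective smooth immersion. -/
structure Knot (S : ClosedSurface.{u}) where
  toFun : Circle → S × Circle
  smooth : ContMDiff (𝓡 1) model3 ∞ toFun
  injective : Function.Injective toFun
  immersion : ∀ t, Function.Injective (mfderiv (𝓡 1) model3 toFun t)

instance (S : ClosedSurface.{u}) : CoeFun (Knot S) (fun _ => Circle → S × Circle) :=
  ⟨Knot.toFun⟩

/-- The knot turns `k` times around the factor `S¹`: its `S¹`-coordinate lifts along the covering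
`r ↦ exp (2πir)` to a path in `ℝ` which climbs by `k` while the knot is traversed once. -/
def Knot.HasDegree {S : ClosedSurface.{u}} (K : Knot S) (k : ℤ) : Prop :=
  ∃ h : ℝ → ℝ, Continuous h ∧
    (∀ r : ℝ, (K (Circle.exp (2 * Real.pi * r))).2 = Circle.exp (2 * Real.pi * h r)) ∧
    h 1 - h 0 = k

/-- `L` is a lift of `K` along the covering `p_m : S × S¹ → S × S¹`, `p_m (x, z) = (x, z ^ m)`. -/
def Knot.IsLiftAlong {S : ClosedSurface.{u}} (m : ℤ) (K L : Knot S) : Prop :=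
  ∀ t, ((L t).1, (L t).2 ^ m) = K t

/-! ### Equivalence of knots -/

/-- Smooth isotopy: a smooth one-parameter family of knots. (Reparametrising a knot by an
orientation preserving diffeomorphism of the circle is an isotopy.) -/
def Knot.Isotopic {S : ClosedSurface.{u}} (K K' : Knot S) : Prop :=
  ∃ H : ℝ → Knot S,
    ContMDiff (𝓘(ℝ, ℝ).prod (𝓡 1)) model3 ∞ (fun p : ℝ × Circle => H p.1 p.2) ∧
    H 0 = K ∧ H 1 = K'

/-- The map `φ` preserves the orientations of the surfaces at the points of `U`. -/
def OrientationPreservingOn {S S' : ClosedSurface.{u}} (φ : S → S') (U : Set S) : Prop :=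
  ∀ x ∈ U, 0 < ContinuousLinearMap.det (mfderiv (𝓡 2) (𝓡 2) φ x : Plane →L[ℝ] Plane)

/-- Two readings of "diffeomorphism" in the notion of equivalence of knots in `S × S¹`.

* `ambient`: arbitrary diffeomorphisms of the `3`-manifolds which preserve the degree, that is,
  which preserve the projection to `S¹` up to homotopy.
* `diagrammatic`: products `F × id` with `F` an orientation preserving diffeomorphism of the
  surfaces; orientations are respected throughout. This is the equivalence that is generated by
  local moves of diagrams drawn on surfaces. -/
inductive EquivalenceKind
  | ambient
  | diagrammatic

/-- The diffeomorphisms `S × S¹ ≅ S' × S¹` that are allowed in an equivalence of knots. -/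
def EquivalenceKind.Admits (κ : EquivalenceKind) {S S' : ClosedSurface.{u}}
    (Φ : Diffeomorph model3 model3 (S × Circle) (S' × Circle) ∞) : Prop :=
  match κ with
  | .ambient =>
      ContinuousMap.Homotopic
        (⟨fun p => (Φ p).2, continuous_snd.comp Φ.continuous⟩ : C(S × Circle, Circle))
        ⟨Prod.snd, continuous_snd⟩
  | .diagrammatic =>
      ∃ F : Diffeomorph (𝓡 2) (𝓡 2) S S' ∞,
        OrientationPreservingOn F Set.univ ∧ ∀ p, Φ p = (F p.1, p.2)

/-- The diffeomorphisms between parts of surfaces that are allowed in a destabilization. -/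
def EquivalenceKind.AdmitsOn (κ : EquivalenceKind) {S S' : ClosedSurface.{u}} (φ : S → S')
    (U : Set S) : Prop :=
  match κ with
  | .ambient => True
  | .diagrammatic => OrientationPreservingOn φ U

/-- Destabilization. `C` is a non-contractible smooth simple closed curve on `S` such that the knot
`K` misses the torus `C × S¹`. One cuts `S × S¹` along `C × S¹`, keeps the piece containing `K`,
and glues a copy of `D² × S¹` to each new boundary torus. On the surface: `V` is the component of
`S \ C` over which `K` lies, and `S'` is `V` with every boundary circle capped by a disc. Since a
disc without its centre is a collar, this says that the closed surface `S'` without the finite set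
`F` of the centres of these discs is diffeomorphic to `V`. -/
def Knot.Destabilizes (κ : EquivalenceKind) {S S' : ClosedSurface.{u}} (K : Knot S)
    (K' : Knot S') : Prop :=
  ∃ (C : C(Circle, S)) (V : Set S) (F : Set S') (φ : S → S') (ψ : S' → S),
    ContMDiff (𝓡 1) (𝓡 2) ∞ C ∧ Function.Injective C ∧
    (∀ t, Function.Injective (mfderiv (𝓡 1) (𝓡 2) C t)) ∧ ¬ C.Nullhomotopic ∧
    V = connectedComponentIn (Set.range C)ᶜ (K 1).1 ∧ (∀ t, (K t).1 ∈ V) ∧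
    F.Finite ∧
    ContMDiffOn (𝓡 2) (𝓡 2) ∞ φ V ∧ ContMDiffOn (𝓡 2) (𝓡 2) ∞ ψ Fᶜ ∧
    Set.MapsTo φ V Fᶜ ∧ Set.MapsTo ψ Fᶜ V ∧ Set.InvOn ψ φ V Fᶜ ∧
    κ.AdmitsOn φ V ∧
    ∀ t, K' t = (φ (K t).1, (K t).2)

/-- The elementary steps of an equivalence of knots. -/
inductive KnotStep (κ : EquivalenceKind) :
    (Σ S : ClosedSurface.{u}, Knot S) → (Σ S : ClosedSurface.{u}, Knot S) → Prop
  | isotopy {S : ClosedSurface.{u}} (K K' : Knot S) (h : K.Isotopic K') :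
      KnotStep κ ⟨S, K⟩ ⟨S, K'⟩
  | diffeomorphism {S S' : ClosedSurface.{u}} (K : Knot S) (K' : Knot S')
      (Φ : Diffeomorph model3 model3 (S × Circle) (S' × Circle) ∞) (hΦ : κ.Admits Φ)
      (h : ∀ t, K' t = Φ (K t)) :
      KnotStep κ ⟨S, K⟩ ⟨S', K'⟩
  | destabilization {S S' : ClosedSurface.{u}} (K : Knot S) (K' : Knot S')
      (h : K.Destabilizes κ K') :
      KnotStep κ ⟨S, K⟩ ⟨S', K'⟩

/-- Equivalence of knots in `S × S¹` and `S' × S¹`: isotopies, diffeomorphisms, destabilizations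
and their inverses. -/
def KnotEquivalent (κ : EquivalenceKind) {S S' : ClosedSurface.{u}} (K : Knot S)
    (K' : Knot S') : Prop :=
  Relation.EqvGen (KnotStep κ) ⟨S, K⟩ ⟨S', K'⟩

/-! ### Diagrams -/

/-- The position of a point of the circle, counterclockwise from `1`, as a number in `[0, 1)`. -/
noncomputable def turn (z : Circle) : ℝ := Int.fract (Complex.arg (z : ℂ) / (2 * Real.pi))

/-- `s` and `t` are the two preimages of a double point of the curve. -/
def IsDouble {S : ClosedSurface.{u}} (γ : Circle → S) (s t : Circle) : Prop :=
  s ≠ t ∧ γ s = γ t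

/-- An oriented diagram on `S` of a knot in `S × S¹`: a generic immersed closed curve with over/under
information at the (transverse, finitely many) double points, and with finitely many vertices
("double lines"), away from the double points. At a vertex in `up` the knot passes upwards through
the level at which `S × S¹` is cut open (the longer line comes first in the direction of the knot,
then the shorter one); at a vertex in `down` it passes downwards. -/
structure Diagram (S : ClosedSurface.{u}) where
  curve : Circle → S
  smooth : ContMDiff (𝓡 1) (𝓡 2) ∞ curve
  immersion : ∀ t, Function.Injective (mfderiv (𝓡 1) (𝓡 2) curve t)
  finite_double : {p : Circle × Circle | IsDouble curve p.1 p.2}.Finite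
  no_triple : ∀ r s t, IsDouble curve r s → IsDouble curve r t → s = t
  transverse : ∀ s t, IsDouble curve s t → ∀ u v : EuclideanSpace ℝ (Fin 1),
    (mfderiv (𝓡 1) (𝓡 2) curve s u : Plane) = (mfderiv (𝓡 1) (𝓡 2) curve t v : Plane) →
      u = 0 ∧ v = 0
  /-- `above s t`: at a crossing, the strand through `s` is the over-strand, that through `t` the
  under-strand. -/
  above : Circle → Circle → Prop
  above_double : ∀ s t, above s t → IsDouble curve s t
  above_iff : ∀ s t, IsDouble curve s t → (above s t ↔ ¬ above t s)
  up : Finset Circle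
  down : Finset Circle
  disjoint : Disjoint up down
  vertex_simple : ∀ v, v ∈ up ∨ v ∈ down → ∀ t, ¬ IsDouble curve v t

namespace Diagram

variable {S : ClosedSurface.{u}}

/-- `D` is the diagram of the knot `K`, where `S × S¹` is cut open along `S × {1}` to `S × [0, 1]`
(the height being `turn`): the curve is the projection of `K`, the vertices are the points where `K`
crosses `S × {1}`, transversally and in the given direction, and over-strands are the higher
ones. -/
def Presents (D : Diagram S) (K : Knot S) : Prop :=
  (∀ t, (K t).1 = D.curve t) ∧
  (∀ t, (K t).2 = 1 ↔ t ∈ D.up ∨ t ∈ D.down) ∧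
  (∀ v ∈ D.up, 0 < deriv (fun r : ℝ => ((K (v * Circle.exp r)).2 : ℂ).im) 0) ∧
  (∀ v ∈ D.down, deriv (fun r : ℝ => ((K (v * Circle.exp r)).2 : ℂ).im) 0 < 0) ∧
  (∀ s t, D.above s t → turn (K t).2 < turn (K s).2)

/-- Diagrams are equivalent if they are diagrams of equivalent knots. -/
def Equivalent (κ : EquivalenceKind) {S' : ClosedSurface.{u}} (D : Diagram S)
    (D' : Diagram S') : Prop :=
  ∃ (K : Knot S) (K' : Knot S'), D.Presents K ∧ D'.Presents K' ∧ KnotEquivalent κ K K'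

/-- The number of upward vertices minus the number of downward vertices. -/
def degree (D : Diagram S) : ℤ := (D.up.card : ℤ) - (D.down.card : ℤ)

open Classical in
/-- The label of the arc of the diagram arriving at `t`: walking along the diagram from the fixed
point `b` with label `0`, the label goes up by one at upward vertices and down by one at downward
vertices. (At a vertex `t`, this is the label before `t`.) -/
noncomputable def label (D : Diagram S) (b t : Circle) : ℤ :=
  ((D.up.filter fun v => turn (v / b) < turn (t / b)).card : ℤ) -
    ((D.down.filter fun v => turn (v / b) < turn (t / b)).card : ℤ)

/-- The layer, among `0, …, |k| - 1` with `k` the degree, on which the arc arriving at `t` is drawn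
in the lifted diagram: the label modulo `|k|`. -/
noncomputable def layer (D : Diagram S) (b t : Circle) : ℤ := D.label b t % |D.degree|

open Classical in
/-- The lifted diagram of a diagram of degree `k ≠ 0`. Its arcs are distributed over `|k|` layers,
stacked upon each other. Strands on higher layers are over strands on lower layers; strands on the
same layer cross as they did in the given diagram. At an upward vertex the walk continues on the
next higher layer and at a downward vertex on the next lower one, without a vertex in the lifted
diagram; only where the walk goes from the top layer up to the bottom layer, or from the bottom
layer down to the top layer, does the lifted diagram have a vertex. -/
noncomputable def lift (D : Diagram S) (b : Circle) : Diagram S where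
  curve := D.curve
  smooth := D.smooth
  immersion := D.immersion
  finite_double := D.finite_double
  no_triple := D.no_triple
  transverse := D.transverse
  above s t := IsDouble D.curve s t ∧
    (D.layer b t < D.layer b s ∨ D.layer b s = D.layer b t ∧ D.above s t)
  above_double _ _ h := h.1
  above_iff s t h := by
    have h' : IsDouble D.curve t s := ⟨h.1.symm, h.2.symm⟩
    have h₁ := D.above_iff s t h
    rcases lt_trichotomy (D.layer b s) (D.layer b t) with hlt | heq | hgt
    · simp [h, h', hlt, hlt.ne, hlt.not_gt]
    · simp [h, h', heq, h₁]
    · simp [h, h', hgt, hgt.ne, hgt.not_gt]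
  up := D.up.filter fun v => D.layer b v = |D.degree| - 1
  down := D.down.filter fun v => D.layer b v = 0
  disjoint := Finset.disjoint_filter_filter D.disjoint
  vertex_simple v hv := D.vertex_simple v
    (hv.imp (fun h => (Finset.mem_filter.mp h).1) fun h => (Finset.mem_filter.mp h).1)

end Diagram

/-! An equivalence of knots never changes the winding of the height: across each elementary step the
heights differ by a factor `Circle.exp (u t)` with `u` continuous and real-valued. Hence the degree
is invariant. Moreover a real angle can be divided by `m`, so each step lifts along `p_m` to a step
of the same kind that twists by `u / m`. `Knot.TwistRelated` records both facts; it composes along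
chains of steps (`KnotEquivalent.exists_twistRelated`). The twist reaches only one particular lift
of the target knot, but two lifts differ by a deck transformation, a rotation of the circle factor,
which is isotopic to the identity. This gives `KnotEquivalent.lift`.

Diagrams enter through two facts. Interpolating heights shows that knots with the same diagram are
isotopic (`Diagram.Presents.isotopic`), so statements about one presented knot pass to all. And
`turn` jumps at vertices exactly oppositely to the label, so height plus label is a continuous real
height along the walk. Its total climb is the degree of the diagram, and dividing it by `|k|` gives
the lift whose diagram is the layered one (`Diagram.Presents.lift`). -/

section

open Set Filter Topology unitInterval

/-! ### Angles and roots of circle-valued maps, by covering theory -/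

namespace Circle

/-- A homotopy of maps to the circle is a rotation by a continuous angle. -/
theorem exists_angle {A : Type*} [TopologicalSpace A] (F : C(I × A, Circle)) :
    ∃ g : C(I × A, ℝ), (∀ a, g (0, a) = 0) ∧
      ∀ s a, F (s, a) = F (0, a) * Circle.exp (g (s, a)) := by
  -- Normalised to be `1` at time `0`, so that the constant `0` can start the lifted homotopy.
  let Q : C(I × A, Circle) := ⟨fun p => F p / F (0, p.2), by fun_prop⟩
  have hQ : ∀ a, Q (0, a) = Circle.exp ((ContinuousMap.const A (0 : ℝ)) a) := by
    intro a; simp [Q]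
  refine ⟨isCoveringMap_exp.liftHomotopy Q _ hQ, fun a => ?_, fun s a => ?_⟩
  · exact isCoveringMap_exp.liftHomotopy_zero Q _ hQ a
  · have := congrFun (isCoveringMap_exp.liftHomotopy_lifts Q _ hQ) (s, a)
    simp only [Function.comp_apply] at this
    rw [this]
    simp [Q]

/-- A map from the line to the circle lifts to the line. -/
theorem exists_real_lift {f : ℝ → Circle} (hf : Continuous f) :
    ∃ h : ℝ → ℝ, Continuous h ∧ ∀ r, f r = Circle.exp (h r) := by
  obtain ⟨h, ⟨-, hh⟩, -⟩ := isCoveringMap_exp.existsUnique_continuousMap_lifts ⟨f, hf⟩ 0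
    (Complex.arg (f 0)) (exp_arg _)
  exact ⟨h, h.continuous, fun r => (congrFun hh r).symm⟩

/-- Two angles of the same map differ by a constant. -/
theorem sub_eq_sub_of_exp_eq {X : Type*} [TopologicalSpace X] [PreconnectedSpace X]
    {g h : X → ℝ} (hg : Continuous g) (hh : Continuous h)
    (e : ∀ x, Circle.exp (g x) = Circle.exp (h x)) (x y : X) : g x - h x = g y - h y := by
  have := isCoveringMap_exp.eq_of_comp_eq (g₁ := g) (g₂ := fun z => h z + (g y - h y)) hg
    (by fun_prop) (by funext z; simp [exp_add, e]) y (by ring)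
  rw [congrFun this x]; ring

/-- Two continuous roots of the same map differ by a constant. -/
theorem div_eq_div_of_zpow_eq {X : Type*} [TopologicalSpace X] [PreconnectedSpace X]
    {m : ℤ} (hm : m ≠ 0) {u v : X → Circle} (hu : Continuous u) (hv : Continuous v)
    (e : ∀ x, u x ^ m = v x ^ m) (x y : X) : u x / v x = u y / v y := by
  have : NeZero m := ⟨hm⟩
  have := (isQuotientCoveringMap_zpow m).isCoveringMap.eq_of_comp_eq
    (g₁ := u) (g₂ := fun z => v z * (u y / v y)) hu (by fun_prop)
    (by funext z; simp [mul_zpow, div_zpow, e]) y (by simp)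
  rw [congrFun this x]; simp

/-- A self-map of the circle of degree `k` is the `k`-th power rotated by a continuous angle. -/
theorem exists_angle_of_lift {f : Circle → Circle} (k : ℤ) {h : ℝ → ℝ}
    (hh : Continuous h) (e : ∀ r, f (Circle.exp (2 * Real.pi * r)) = Circle.exp (2 * Real.pi * h r))
    (hk : h 1 - h 0 = k) : ∃ g : C(Circle, ℝ), ∀ t, f t = t ^ k * Circle.exp (g t) := by
  -- `h (· + 1)` and `h` lift the same map, so their difference is constant.
  have hp : ∀ r, h (r + 1) - h r = k := by
    intro r
    have := sub_eq_sub_of_exp_eq (g := fun r => 2 * Real.pi * h (r + 1))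
      (h := fun r => 2 * Real.pi * h r) (by fun_prop) (by fun_prop)
      (fun r => by rw [← e, ← e, mul_add, mul_one, exp_add_two_pi]) r 0
    have h2 : (2 * Real.pi) * (h (r + 1) - h r) = 2 * Real.pi * (h (0 + 1) - h 0) := by
      linarith
    rw [mul_left_cancel₀ (by positivity) h2, zero_add, hk]
  -- Without its linear part the lift is periodic and descends to the circle.
  have hper : Function.Periodic (fun x => 2 * Real.pi * h (x / (2 * Real.pi)) - k * x)
      (2 * Real.pi) := by
    intro x
    have e1 : (x + 2 * Real.pi) / (2 * Real.pi) = x / (2 * Real.pi) + 1 := by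
      field_simp
    have : h ((x + 2 * Real.pi) / (2 * Real.pi)) = h (x / (2 * Real.pi)) + k := by
      rw [e1]; linarith [hp (x / (2 * Real.pi))]
    change 2 * Real.pi * h ((x + 2 * Real.pi) / (2 * Real.pi)) - k * (x + 2 * Real.pi) = _
    rw [this]; field_simp; ring
  refine ⟨⟨fun t => hper.lift (AddCircle.homeomorphCircle'.symm t), ?_⟩, fun t => ?_⟩
  · refine Continuous.comp ?_ AddCircle.homeomorphCircle'.symm.continuous
    exact continuous_coinduced_dom.mpr (by
      change Continuous (fun x => 2 * Real.pi * h (x / (2 * Real.pi)) - k * x); fun_prop)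
  · obtain ⟨x, rfl⟩ := exp_surjective t
    have : AddCircle.homeomorphCircle'.symm (Circle.exp x) = (x : AddCircle (2 * Real.pi)) := by
      rw [Homeomorph.symm_apply_eq]; rfl
    change _ = _ * Circle.exp (hper.lift (AddCircle.homeomorphCircle'.symm (Circle.exp x)))
    rw [this, Function.Periodic.lift_coe]
    rw [← exp_intCast_mul, ← exp_add, add_sub_cancel, ← e]
    congr 2; field_simp

theorem zpow_mul_exp_lift (k : ℤ) (g : Circle → ℝ) (r : ℝ) :
    Circle.exp (2 * Real.pi * r) ^ k * Circle.exp (g (Circle.exp (2 * Real.pi * r))) =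
      Circle.exp (2 * Real.pi * (k * r + g (Circle.exp (2 * Real.pi * r)) / (2 * Real.pi))) := by
  rw [← exp_intCast_mul, ← exp_add]; congr 1; field_simp

end Circle

/-! ### Smoothness of angles and roots of smooth circle-valued maps -/

section smooth

variable {E : Type*} [NormedAddCommGroup E] [NormedSpace ℝ E] {H : Type*} [TopologicalSpace H]
  {J : ModelWithCorners ℝ E H} {M : Type*} [TopologicalSpace M] [ChartedSpace H M]

attribute [local instance] finrank_real_complex_fact'

theorem Circle.contMDiff_coe {n : ℕ∞ω} : ContMDiff (𝓡 1) 𝓘(ℝ, ℂ) n (fun z : Circle => (z : ℂ)) :=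
  contMDiff_coe_sphere

theorem Circle.contMDiff_div {f g : M → Circle} (hf : ContMDiff J (𝓡 1) ∞ f)
    (hg : ContMDiff J (𝓡 1) ∞ g) : ContMDiff J (𝓡 1) ∞ fun x => f x / g x := by
  have : LieGroup (𝓡 1) ∞ Circle := LieGroup.of_le (n := ω) le_top
  exact hf.div hg

theorem Circle.contMDiff_mul' {f g : M → Circle} (hf : ContMDiff J (𝓡 1) ∞ f)
    (hg : ContMDiff J (𝓡 1) ∞ g) : ContMDiff J (𝓡 1) ∞ fun x => f x * g x := by
  have : LieGroup (𝓡 1) ∞ Circle := LieGroup.of_le (n := ω) le_top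
  exact hf.mul hg

theorem Circle.contMDiff_zpow {f : M → Circle} (hf : ContMDiff J (𝓡 1) ∞ f) (m : ℤ) :
    ContMDiff J (𝓡 1) ∞ fun x => f x ^ m := by
  have : LieGroup (𝓡 1) ∞ Circle := LieGroup.of_le (n := ω) le_top
  cases m with
  | ofNat m => simpa using hf.pow m
  | negSucc m => simpa only [zpow_negSucc] using (hf.pow (m + 1)).inv

/-- Dividing by `z p` moves the base value to `1`, away from the branch cut of `Complex.arg`. -/
theorem Circle.contMDiffAt_arg_div {z : M → Circle} (hz : ContMDiff J (𝓡 1) ∞ z) (p : M) :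
    ContMDiffAt J 𝓘(ℝ, ℝ) ∞ (fun q => Complex.arg ((z q / z p : Circle) : ℂ)) p := by
  have h1 : ContMDiffAt J 𝓘(ℝ, ℂ) ∞ (fun q => ((z q / z p : Circle) : ℂ)) p :=
    (Circle.contMDiff_coe.comp (Circle.contMDiff_div hz contMDiff_const)) p
  have h2 : ContDiffAt ℝ ∞ (fun w : ℂ => (Complex.log w).im) ((z p / z p : Circle) : ℂ) := by
    have : ContDiffAt ℝ ∞ Complex.log ((z p / z p : Circle) : ℂ) :=
      (Complex.contDiffAt_log (n := ∞) (by simp)).restrict_scalars ℝ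
    exact Complex.imCLM.contDiff.contDiffAt.comp _ this
  exact (h2.contMDiffAt.comp p h1).congr_of_eventuallyEq
    (Eventually.of_forall fun q => by simp [Complex.log_im])

theorem Circle.contMDiff_of_exp {g : M → ℝ} (hg : Continuous g)
    (h : ContMDiff J (𝓡 1) ∞ fun x => Circle.exp (g x)) : ContMDiff J 𝓘(ℝ, ℝ) ∞ g := by
  intro p
  have hn : ∀ᶠ q in 𝓝 p, |g q - g p| < Real.pi := by
    have : ContinuousAt (fun q => |g q - g p|) p := by fun_prop
    exact this.eventually_lt_const (by simp [Real.pi_pos])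
  refine ((contMDiffAt_const (c := g p)).add
    (Circle.contMDiffAt_arg_div h p)).congr_of_eventuallyEq ?_
  filter_upwards [hn] with q hq
  rw [abs_lt] at hq
  change g q = g p + Complex.arg ((Circle.exp (g q) / Circle.exp (g p) : Circle) : ℂ)
  rw [← exp_sub, Circle.arg_exp hq.1 hq.2.le]; ring

/-- Near `p` the root is recovered from its power by dividing an argument by `m`. The bound `π` on
`m` times the argument of `w q / w p` ensures that taking the power does not cross the branch cut.
Thus lifts need only be constructed continuously. -/
theorem Circle.contMDiff_of_zpow {w : M → Circle} (hw : Continuous w) {m : ℤ} (hm : m ≠ 0)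
    (h : ContMDiff J (𝓡 1) ∞ fun x => w x ^ m) : ContMDiff J (𝓡 1) ∞ w := by
  intro p
  have hn : ∀ᶠ q in 𝓝 p, |m * Complex.arg ((w q / w p : Circle) : ℂ)| < Real.pi := by
    have : ContinuousAt (fun q => |m * Complex.arg ((w q / w p : Circle) : ℂ)|) p := by
      refine (continuousAt_const.mul (ContinuousAt.comp (Complex.continuousAt_arg ?_) ?_)).abs
      · simp
      · fun_prop
    exact this.eventually_lt_const (by simp [Real.pi_pos])
  have h1 : ContMDiffAt J 𝓘(ℝ, ℝ) ∞
      (fun q => (m : ℝ)⁻¹ * Complex.arg ((w q ^ m / w p ^ m : Circle) : ℂ)) p :=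
    contMDiffAt_const.mul (Circle.contMDiffAt_arg_div h p)
  have : LieGroup (𝓡 1) ∞ Circle := LieGroup.of_le (n := ω) le_top
  refine ((contMDiffAt_const (c := w p)).mul
    (contMDiff_circleExp.contMDiffAt.comp p h1)).congr_of_eventuallyEq ?_
  filter_upwards [hn] with q hq
  rw [abs_lt] at hq
  have hm' : (m : ℝ) ≠ 0 := by exact_mod_cast hm
  change w q = w p * Circle.exp
    ((m : ℝ)⁻¹ * Complex.arg ((w q ^ m / w p ^ m : Circle) : ℂ))
  have e : w q ^ m / w p ^ m = Circle.exp (m * Complex.arg ((w q / w p : Circle) : ℂ)) := by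
    rw [exp_intCast_mul, exp_arg, div_zpow]
  rw [e, Circle.arg_exp hq.1 hq.2.le, inv_mul_cancel_left₀ hm', exp_arg]
  simp

end smooth

end

/-! ### Knots, their degree, and their lifts -/

section

open Set Filter Topology unitInterval

/-- By the chain rule. It makes lifts immersions because their images under the covering are, and
makes every smooth choice of heights over an immersed curve an immersion. -/
theorem injective_mfderiv_of_comp {E₁ E₂ E₃ H₁ H₂ H₃ M₁ M₂ M₃ : Type*}
    [NormedAddCommGroup E₁] [NormedSpace ℝ E₁] [TopologicalSpace H₁] [TopologicalSpace M₁]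
    [ChartedSpace H₁ M₁] {I₁ : ModelWithCorners ℝ E₁ H₁}
    [NormedAddCommGroup E₂] [NormedSpace ℝ E₂] [TopologicalSpace H₂] [TopologicalSpace M₂]
    [ChartedSpace H₂ M₂] {I₂ : ModelWithCorners ℝ E₂ H₂}
    [NormedAddCommGroup E₃] [NormedSpace ℝ E₃] [TopologicalSpace H₃] [TopologicalSpace M₃]
    [ChartedSpace H₃ M₃] {I₃ : ModelWithCorners ℝ E₃ H₃}
    {f : M₁ → M₂} {g : M₂ → M₃} (hf : ContMDiff I₁ I₂ ∞ f) (hg : ContMDiff I₂ I₃ ∞ g) (x : M₁)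
    (h : Function.Injective (mfderiv I₁ I₃ (fun y => g (f y)) x)) :
    Function.Injective (mfderiv I₁ I₂ f x) := by
  have hc : mfderiv I₁ I₃ (g ∘ f) x = (mfderiv I₂ I₃ g (f x)).comp (mfderiv I₁ I₂ f x) :=
    mfderiv_comp x ((hg (f x)).mdifferentiableAt (by simp)) ((hf x).mdifferentiableAt (by simp))
  change Function.Injective (mfderiv I₁ I₃ (g ∘ f) x) at h
  rw [hc] at h
  intro a b hab
  exact h (congrArg (mfderiv I₂ I₃ g (f x)) hab)

variable {S S' : ClosedSurface.{u}}

namespace Knot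

theorem ext_apply {K L : Knot S} (h : ∀ t, K t = L t) : K = L := by
  cases K; cases L; congr; exact funext h

theorem continuous (K : Knot S) : Continuous K := K.smooth.continuous

theorem continuous_height (K : Knot S) : Continuous fun t => (K t).2 := K.continuous.snd

theorem contMDiff_curve (K : Knot S) : ContMDiff (𝓡 1) (𝓡 2) ∞ fun t => (K t).1 :=
  contMDiff_fst.comp K.smooth

theorem contMDiff_height (K : Knot S) : ContMDiff (𝓡 1) (𝓡 1) ∞ fun t => (K t).2 :=
  contMDiff_snd.comp K.smooth

/-! ### The degree -/

/-- The form in which degrees are used below: the angle lives on the circle itself, so it can be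
added and divided. -/
theorem hasDegree_iff {K : Knot S} {k : ℤ} :
    K.HasDegree k ↔ ∃ g : C(Circle, ℝ), ∀ t, (K t).2 = t ^ k * Circle.exp (g t) := by
  constructor
  · rintro ⟨h, hc, he, hk⟩
    exact Circle.exists_angle_of_lift (f := fun t => (K t).2) k hc he hk
  · rintro ⟨g, hg⟩
    refine ⟨fun r => k * r + g (Circle.exp (2 * Real.pi * r)) / (2 * Real.pi), by fun_prop,
      fun r => ?_, ?_⟩
    · rw [hg, Circle.zpow_mul_exp_lift]
    · simp

theorem exists_hasDegree (K : Knot S) : ∃ k, K.HasDegree k := by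
  obtain ⟨h, hh, e⟩ := Circle.exists_real_lift
    (f := fun r => (K (Circle.exp (2 * Real.pi * r))).2)
    (K.continuous_height.comp (by fun_prop : Continuous fun r => Circle.exp (2 * Real.pi * r)))
  have : Circle.exp (h 1) = Circle.exp (h 0) := by rw [← e, ← e]; simp
  obtain ⟨k, hk⟩ := Circle.exp_eq_exp.mp this
  refine ⟨k, fun r => h r / (2 * Real.pi), by fun_prop, fun r => ?_, ?_⟩
  · rw [e]; congr 1; field_simp
  · beta_reduce; rw [hk]; field_simp; ring

theorem HasDegree.unique {K : Knot S} {k l : ℤ} (hk : K.HasDegree k) (hl : K.HasDegree l) :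
    k = l := by
  obtain ⟨g, hg, eg, rfl'⟩ := hk
  obtain ⟨h, hh, eh, rfl''⟩ := hl
  have := Circle.sub_eq_sub_of_exp_eq (g := fun r => 2 * Real.pi * g r)
    (h := fun r => 2 * Real.pi * h r) (by fun_prop) (by fun_prop)
    (fun r => by rw [← eg, ← eh]) 1 0
  have h2 : (2 * Real.pi) * (g 1 - g 0) = 2 * Real.pi * (h 1 - h 0) := by linarith
  have h3 := mul_left_cancel₀ (by positivity) h2
  rw [rfl', rfl''] at h3
  exact_mod_cast h3

theorem HasDegree.of_height_eq {K : Knot S} {K' : Knot S'} {k : ℤ} (hk : K.HasDegree k)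
    (u : C(Circle, ℝ)) (h : ∀ t, (K' t).2 = (K t).2 * Circle.exp (u t)) : K'.HasDegree k := by
  obtain ⟨g, hg⟩ := hasDegree_iff.mp hk
  exact hasDegree_iff.mpr ⟨g + u, fun t => by
    rw [h, hg, mul_assoc, ← Circle.exp_add]; rfl⟩

/-! ### Lifts along the coverings -/

/-- A smooth map which becomes a knot after composition with a smooth map is a knot. -/
def ofComp (K : Knot S) (f : Circle → S × Circle) (hf : ContMDiff (𝓡 1) model3 ∞ f)
    (q : S × Circle → S × Circle) (hq : ContMDiff model3 model3 ∞ q) (h : ∀ t, q (f t) = K t) :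
    Knot S where
  toFun := f
  smooth := hf
  injective s t hst := K.injective (by rw [← h, ← h, hst])
  immersion t := by
    have e : (fun t => q (f t)) = K := funext h
    refine injective_mfderiv_of_comp hf hq t ?_
    rw [e]
    exact K.immersion t

/-- The knot over the same curve as `K` whose height is an `m`-th root of that of `K`. -/
noncomputable def root (K : Knot S) {m : ℤ} (hm : m ≠ 0) (w : Circle → Circle) (hw : Continuous w)
    (h : ∀ t, w t ^ m = (K t).2) : Knot S :=
  K.ofComp (fun t => ((K t).1, w t))
    (K.contMDiff_curve.prodMk
      (Circle.contMDiff_of_zpow hw hm (by simpa only [h] using K.contMDiff_height)))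
    (fun p => (p.1, p.2 ^ m))
    (contMDiff_fst.prodMk (Circle.contMDiff_zpow contMDiff_snd m))
    fun t => Prod.ext rfl (h t)

theorem isLiftAlong_root (K : Knot S) {m : ℤ} (hm : m ≠ 0) (w : Circle → Circle)
    (hw : Continuous w) (h : ∀ t, w t ^ m = (K t).2) : K.IsLiftAlong m (K.root hm w hw h) :=
  fun t => Prod.ext rfl (h t)

theorem IsLiftAlong.fst {m : ℤ} {K L : Knot S} (h : K.IsLiftAlong m L) (t : Circle) :
    (L t).1 = (K t).1 := (Prod.ext_iff.mp (h t)).1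

theorem IsLiftAlong.snd {m : ℤ} {K L : Knot S} (h : K.IsLiftAlong m L) (t : Circle) :
    (L t).2 ^ m = (K t).2 := (Prod.ext_iff.mp (h t)).2

theorem exists_isLiftAlong {K : Knot S} {m d : ℤ} (hm : m ≠ 0) (hK : K.HasDegree (m * d)) :
    ∃ L, K.IsLiftAlong m L := by
  obtain ⟨g, hg⟩ := hasDegree_iff.mp hK
  -- The height is `t ^ (m * d)` times the exponential of `g`, with an evident `m`-th root.
  refine ⟨_, K.isLiftAlong_root hm (fun t => t ^ d * Circle.exp (g t / m)) (by fun_prop) fun t => ?_⟩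
  have : (m : ℝ) ≠ 0 := by exact_mod_cast hm
  rw [hg, mul_zpow, ← zpow_mul, mul_comm d, ← Circle.exp_intCast_mul]
  congr 2; field_simp

theorem IsLiftAlong.hasDegree {K L : Knot S} {m d : ℤ} (hm : m ≠ 0) (hL : K.IsLiftAlong m L)
    (hK : K.HasDegree (m * d)) : L.HasDegree d := by
  obtain ⟨e, he⟩ := L.exists_hasDegree
  obtain ⟨g, hg⟩ := hasDegree_iff.mp he
  have : K.HasDegree (m * e) := by
    refine hasDegree_iff.mpr ⟨⟨fun t => m * g t, by fun_prop⟩, fun t => ?_⟩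
    rw [← hL.snd, hg, mul_zpow, ← zpow_mul, mul_comm e]
    simp
  rwa [mul_left_cancel₀ hm (hK.unique this)]

/-- The knot `K` turned by `c` in the direction of the circle. -/
noncomputable def rotate (K : Knot S) (c : Circle) : Knot S :=
  K.ofComp (fun t => ((K t).1, (K t).2 * c))
    (K.contMDiff_curve.prodMk (Circle.contMDiff_mul' K.contMDiff_height contMDiff_const))
    (fun p => (p.1, p.2 / c))
    (contMDiff_fst.prodMk (Circle.contMDiff_div contMDiff_snd contMDiff_const))
    fun t => Prod.ext rfl (mul_div_cancel_right (K t).2 c)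

theorem isotopic_rotate (K : Knot S) (c : Circle) : K.Isotopic (K.rotate c) := by
  obtain ⟨θ, rfl⟩ := Circle.exp_surjective c
  refine ⟨fun s => K.rotate (Circle.exp (s * θ)), ?_, ?_, ?_⟩
  · refine (K.contMDiff_curve.comp contMDiff_snd).prodMk
      (Circle.contMDiff_mul' (K.contMDiff_height.comp contMDiff_snd)
        (contMDiff_circleExp.comp ?_))
    exact contMDiff_fst.mul contMDiff_const
  · exact ext_apply fun t => Prod.ext rfl (by simp [rotate, ofComp])
  · exact ext_apply fun t => Prod.ext rfl (by simp [rotate, ofComp])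

/-- All lifts of a knot along one of the coverings are isotopic. -/
theorem IsLiftAlong.isotopic {K L L' : Knot S} {m : ℤ} (hm : m ≠ 0) (hL : K.IsLiftAlong m L)
    (hL' : K.IsLiftAlong m L') : L.Isotopic L' := by
  -- The circle is connected, so the quotient of two `m`-th roots of one height is constant and can
  -- be read off at `1`.
  convert! L.isotopic_rotate ((L' 1).2 / (L 1).2) using 1
  refine ext_apply fun t => Prod.ext ?_ ?_
  · exact (hL'.fst t).trans (hL.fst t).symm
  · have := Circle.div_eq_div_of_zpow_eq hm L'.continuous_height L.continuous_height
      (fun t => by rw [hL.snd, hL'.snd]) t 1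
    change _ = (L t).2 * _
    rw [← this, mul_div_cancel]

end Knot

end

/-! ### Lifting the steps of an equivalence -/

section

open Set Filter Topology unitInterval

variable {S S' S'' : ClosedSurface.{u}}

/-- The heights of `K` and `K'` differ by the angle `u`, and dividing this angle by `m` relates lifts
of `K` and of `K'` along the covering `p_m` which are equivalent. -/
def Knot.TwistRelated (κ : EquivalenceKind) (K : Knot S) (K' : Knot S') (u : C(Circle, ℝ)) : Prop :=
  (∀ t, (K' t).2 = (K t).2 * Circle.exp (u t)) ∧
    ∀ (m : ℤ), m ≠ 0 → ∀ (L : Knot S) (L' : Knot S'), K.IsLiftAlong m L → K'.IsLiftAlong m L' →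
      (∀ t, (L' t).2 = (L t).2 * Circle.exp (u t / m)) → KnotEquivalent κ L L'

namespace Knot

theorem exp_div_zpow {m : ℤ} (hm : m ≠ 0) (x : ℝ) : Circle.exp (x / m) ^ m = Circle.exp x := by
  have : (m : ℝ) ≠ 0 := by exact_mod_cast hm
  rw [← Circle.exp_intCast_mul]; congr 1; field_simp

theorem IsLiftAlong.twist_zpow {K L : Knot S} {K' : Knot S'} {m : ℤ} (hm : m ≠ 0)
    (hL : K.IsLiftAlong m L) {u : C(Circle, ℝ)} (hu : ∀ t, (K' t).2 = (K t).2 * Circle.exp (u t))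
    (t : Circle) : ((L t).2 * Circle.exp (u t / m)) ^ m = (K' t).2 := by
  rw [mul_zpow, hL.snd, exp_div_zpow hm, hu]

theorem continuous_twist (L : Knot S) (u : C(Circle, ℝ)) (m : ℤ) :
    Continuous fun t => (L t).2 * Circle.exp (u t / m) :=
  L.continuous_height.mul (by fun_prop)

namespace TwistRelated

variable {κ : EquivalenceKind} {K : Knot S} {K' : Knot S'} {K'' : Knot S''} {u v : C(Circle, ℝ)}

theorem refl (K : Knot S) : K.TwistRelated κ K 0 := by
  refine ⟨fun t => by simp, fun m _ L L' hL hL' h => ?_⟩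
  obtain rfl : L' = L := by
    refine Knot.ext_apply fun t => Prod.ext ((hL'.fst t).trans (hL.fst t).symm) ?_
    simpa using h t
  exact Relation.EqvGen.refl _

theorem symm (h : K.TwistRelated κ K' u) : K'.TwistRelated κ K (-u) := by
  refine ⟨fun t => by simp [h.1], fun m hm L L' hL hL' e => ?_⟩
  refine Relation.EqvGen.symm _ _ (h.2 m hm L' L hL' hL fun t => ?_)
  rw [e, mul_assoc, ← Circle.exp_add]
  simp [neg_div]

theorem trans (h : K.TwistRelated κ K' u) (h' : K'.TwistRelated κ K'' v) :
    K.TwistRelated κ K'' (u + v) := by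
  refine ⟨fun t => ?_, fun m hm L L' hL hL' e => ?_⟩
  · rw [h'.1, h.1, mul_assoc, ← Circle.exp_add]; rfl
  -- The intermediate lift is `L` twisted by `u / m`, placed over the curve of `K'`.
  · have hM := K'.isLiftAlong_root hm _ (L.continuous_twist u m) (hL.twist_zpow hm h.1)
    refine Relation.EqvGen.trans _ _ _ (h.2 m hm L _ hL hM fun t => rfl)
      (h'.2 m hm _ L' hM hL' fun t => ?_)
    rw [e]
    change _ = (L t).2 * Circle.exp (u t / m) * _
    rw [mul_assoc, ← Circle.exp_add, ← add_div]; rfl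

end TwistRelated

/-- The real time of a smooth isotopy, slowed down so as to stay in the unit interval. -/
noncomputable def clampedTime (s : ℝ) : I :=
  ⟨Real.smoothTransition s, Real.smoothTransition.nonneg s, Real.smoothTransition.le_one s⟩

theorem contDiff_clampedTime : ContDiff ℝ ∞ fun s => (clampedTime s : ℝ) :=
  Real.smoothTransition.contDiff

theorem continuous_clampedTime : Continuous clampedTime :=
  Real.smoothTransition.continuous.subtype_mk _

theorem clampedTime_zero : clampedTime 0 = 0 := Subtype.ext Real.smoothTransition.zero

theorem clampedTime_one : clampedTime 1 = 1 := Subtype.ext Real.smoothTransition.one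

theorem Isotopic.equivalent (κ : EquivalenceKind) {K K' : Knot S} (h : K.Isotopic K') :
    KnotEquivalent κ K K' := Relation.EqvGen.rel _ _ (KnotStep.isotopy K K' h)

theorem Isotopic.exists_twistRelated (κ : EquivalenceKind) {K K' : Knot S} (h : K.Isotopic K') :
    ∃ u, K.TwistRelated κ K' u := by
  obtain ⟨H, hH, rfl, rfl⟩ := h
  have hc : Continuous fun p : ℝ × Circle => (H p.1 p.2).2 := hH.continuous.snd
  -- Homotopy lifting yields the angle over `I` only, so the real time of the lifted isotopy is
  -- passed through `clampedTime`.
  obtain ⟨g, g0, hg⟩ := Circle.exists_angle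
    (⟨fun p : I × Circle => (H p.1 p.2).2,
      hc.comp (by fun_prop : Continuous fun p : I × Circle => ((p.1 : ℝ), p.2))⟩ :
      C(I × Circle, Circle))
  simp only [ContinuousMap.coe_mk, Icc.coe_zero] at hg
  refine ⟨⟨fun t => g (1, t), by fun_prop⟩, fun t => by simpa using hg 1 t,
    fun m hm L L' hL hL' e => Isotopic.equivalent κ ?_⟩
  have hw (s : ℝ) : Continuous fun t => (L t).2 * Circle.exp (g (clampedTime s, t) / m) :=
    L.continuous_height.mul (by fun_prop)
  have hz (s : ℝ) (t : Circle) : ((L t).2 * Circle.exp (g (clampedTime s, t) / m)) ^ m =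
      (H (clampedTime s) t).2 := by
    rw [mul_zpow, hL.snd, exp_div_zpow hm, hg]
  refine ⟨fun s => (H (clampedTime s)).root hm _ (hw s) (hz s), ?_, ?_, ?_⟩
  · have hcl : ContMDiff (𝓘(ℝ, ℝ).prod (𝓡 1)) model3 ∞
        fun p : ℝ × Circle => H (clampedTime p.1) p.2 :=
      hH.comp ((contDiff_clampedTime.contMDiff.comp contMDiff_fst).prodMk contMDiff_snd)
    -- The angle `g` is only known to be continuous; smoothness comes from the `m`-th power, the
    -- height of the given isotopy.
    refine (contMDiff_fst.comp hcl).prodMk (Circle.contMDiff_of_zpow ?_ hm ?_)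
    · have := continuous_clampedTime
      exact (L.continuous_height.comp continuous_snd).mul (by fun_prop)
    · simp only [hz]
      exact contMDiff_snd.comp hcl
  · refine Knot.ext_apply fun t => Prod.ext ?_ ?_
    · change (H (clampedTime 0) t).1 = _
      rw [clampedTime_zero, hL.fst]; rfl
    · change (L t).2 * Circle.exp (g (clampedTime 0, t) / m) = _
      rw [clampedTime_zero, g0]; simp
  · refine Knot.ext_apply fun t => Prod.ext ?_ ?_
    · change (H (clampedTime 1) t).1 = _
      rw [clampedTime_one, hL'.fst]; rfl
    · change (L t).2 * Circle.exp (g (clampedTime 1, t) / m) = _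
      rw [clampedTime_one, e]; rfl

/-- A diffeomorphism preserving the projection to the circle up to a rotation by the angle `g` lifts
along the covering `p_m`. -/
noncomputable def liftDiffeomorph (Φ : Diffeomorph model3 model3 (S × Circle) (S' × Circle) ∞)
    (g : C(S × Circle, ℝ)) (hg : ∀ p, (Φ p).2 = p.2 * Circle.exp (g p)) {m : ℤ} (hm : m ≠ 0) :
    Diffeomorph model3 model3 (S × Circle) (S' × Circle) ∞ where
  toFun p := ((Φ (p.1, p.2 ^ m)).1, p.2 * Circle.exp (g (p.1, p.2 ^ m) / m))
  invFun q := ((Φ.symm (q.1, q.2 ^ m)).1,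
    q.2 * Circle.exp (-g (Φ.symm (q.1, q.2 ^ m)) / m))
  left_inv p := by
    have h1 : (p.2 * Circle.exp (g (p.1, p.2 ^ m) / m)) ^ m = (Φ (p.1, p.2 ^ m)).2 := by
      rw [hg, mul_zpow, exp_div_zpow hm]
    simp only [h1, Prod.mk.eta, Diffeomorph.symm_apply_apply]
    rw [mul_assoc, ← Circle.exp_add, neg_div, add_neg_cancel, Circle.exp_zero, mul_one]
  right_inv q := by
    have h1 : (q.2 * Circle.exp (-g (Φ.symm (q.1, q.2 ^ m)) / m)) ^ m =
        (Φ.symm (q.1, q.2 ^ m)).2 := by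
      have := hg (Φ.symm (q.1, q.2 ^ m))
      rw [Diffeomorph.apply_symm_apply] at this
      rw [mul_zpow, exp_div_zpow hm, Circle.exp_neg, ← div_eq_mul_inv, div_eq_iff_eq_mul]
      exact this
    simp only [h1, Prod.mk.eta, Diffeomorph.apply_symm_apply]
    rw [mul_assoc, ← Circle.exp_add, neg_div, neg_add_cancel, Circle.exp_zero, mul_one]
  contMDiff_toFun := by
    have hp : ContMDiff model3 model3 ∞ fun p : S × Circle => Φ (p.1, p.2 ^ m) :=
      Φ.contMDiff.comp
        (contMDiff_fst.prodMk (Circle.contMDiff_zpow contMDiff_snd m))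
    refine (contMDiff_fst.comp hp).prodMk (Circle.contMDiff_of_zpow (by fun_prop) hm ?_)
    convert! contMDiff_snd.comp hp using 1
    funext p
    rw [Function.comp_apply, hg, mul_zpow, exp_div_zpow hm]
  contMDiff_invFun := by
    have hp : ContMDiff model3 model3 ∞ fun p : S' × Circle => Φ.symm (p.1, p.2 ^ m) :=
      Φ.symm.contMDiff.comp
        (contMDiff_fst.prodMk (Circle.contMDiff_zpow contMDiff_snd m))
    have hc := hp.continuous
    refine (contMDiff_fst.comp hp).prodMk (Circle.contMDiff_of_zpow (by fun_prop) hm ?_)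
    convert! contMDiff_snd.comp hp using 1
    funext q
    have := hg (Φ.symm (q.1, q.2 ^ m))
    rw [Diffeomorph.apply_symm_apply] at this
    rw [mul_zpow, exp_div_zpow hm, Circle.exp_neg, ← div_eq_mul_inv, div_eq_iff_eq_mul]
    exact this

/-- Scaling the real angle `g / m` down to `0` is the required homotopy. -/
theorem admits_liftDiffeomorph (Φ : Diffeomorph model3 model3 (S × Circle) (S' × Circle) ∞)
    (g : C(S × Circle, ℝ)) (hg : ∀ p, (Φ p).2 = p.2 * Circle.exp (g p)) {m : ℤ} (hm : m ≠ 0) :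
    EquivalenceKind.ambient.Admits (liftDiffeomorph Φ g hg hm) := by
  refine ⟨⟨⟨fun p => p.2.2 * Circle.exp ((1 - p.1) * (g (p.2.1, p.2.2 ^ m) / m)), by fun_prop⟩,
    fun p => ?_, fun p => ?_⟩⟩
  · change p.2 * Circle.exp ((1 - ((0 : I) : ℝ)) * (g (p.1, p.2 ^ m) / m)) =
      p.2 * Circle.exp (g (p.1, p.2 ^ m) / m)
    simp
  · simp

theorem exists_twistRelated_of_admits {κ : EquivalenceKind} {K : Knot S} {K' : Knot S'}
    {Φ : Diffeomorph model3 model3 (S × Circle) (S' × Circle) ∞} (hΦ : κ.Admits Φ)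
    (h : ∀ t, K' t = Φ (K t)) : ∃ u, K.TwistRelated κ K' u := by
  cases κ with
  | ambient =>
    -- Reversed, the homotopy starts at the projection, and its angle at time `1` measures how `Φ`
    -- turns the circle factor.
    obtain ⟨F⟩ := ContinuousMap.Homotopic.symm hΦ
    obtain ⟨g', -, hg'⟩ := Circle.exists_angle F.toContinuousMap
    let g : C(S × Circle, ℝ) := ⟨fun p => g' (1, p), by fun_prop⟩
    have hg (p) : (Φ p).2 = p.2 * Circle.exp (g p) := by simpa [g] using hg' 1 p
    refine ⟨⟨fun t => g (K t), g.continuous.comp K.continuous⟩, fun t => by rw [h, hg]; rfl,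
      fun m hm L L' hL hL' e => ?_⟩
    refine Relation.EqvGen.rel _ _ (KnotStep.diffeomorphism L L' (liftDiffeomorph Φ g hg hm)
      (admits_liftDiffeomorph Φ g hg hm) fun t => ?_)
    refine Prod.ext ?_ ?_
    · change _ = (Φ ((L t).1, (L t).2 ^ m)).1
      rw [hL t, hL'.fst, h]
    · change _ = (L t).2 * Circle.exp (g ((L t).1, (L t).2 ^ m) / m)
      rw [hL t, e]; rfl
  | diagrammatic =>
    -- A product `F × id` commutes with `p_m`, so `Φ` itself relates the lifts, without a twist.
    obtain ⟨F, -, hF⟩ := id hΦ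
    refine ⟨0, fun t => by simp [h, hF], fun m hm L L' hL hL' e => ?_⟩
    refine Relation.EqvGen.rel _ _ (KnotStep.diffeomorphism L L' Φ hΦ fun t => ?_)
    rw [hF]
    refine Prod.ext ?_ ?_
    · rw [hL'.fst, h, hF, hL.fst]
    · simpa using e t

/-- A destabilization is determined by data on the surfaces and keeps heights. Lifts have the same
projections as the knots, so the same data serve for them. -/
theorem Destabilizes.twistRelated {κ : EquivalenceKind} {K : Knot S} {K' : Knot S'}
    (h : K.Destabilizes κ K') : K.TwistRelated κ K' 0 := by
  obtain ⟨C, V, F, φ, ψ, h1, h2, h3, h4, h5, h6, h7, h8, h9, h10, h11, h12, h13, hK'⟩ := h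
  refine ⟨fun t => by simp [hK'], fun m hm L L' hL hL' e => ?_⟩
  refine Relation.EqvGen.rel _ _ (KnotStep.destabilization L L' ?_)
  refine ⟨C, V, F, φ, ψ, h1, h2, h3, h4, ?_, fun t => ?_, h7, h8, h9, h10, h11, h12, h13,
    fun t => Prod.ext ?_ ?_⟩
  · rw [h5, hL.fst]
  · rw [hL.fst]; exact h6 t
  · rw [hL'.fst, hK', hL.fst]
  · simpa using e t

end Knot

theorem KnotEquivalent.exists_twistRelated {κ : EquivalenceKind} {K : Knot S} {K' : Knot S'}
    (h : KnotEquivalent κ K K') : ∃ u, K.TwistRelated κ K' u := by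
  -- The surface may change along the chain, so the induction runs over pairs of a surface and a
  -- knot.
  suffices H : ∀ p q : Σ S : ClosedSurface.{u}, Knot S, Relation.EqvGen (KnotStep κ) p q →
      ∃ u, p.2.TwistRelated κ q.2 u from H _ _ h
  intro p q hpq
  induction hpq with
  | rel p q hs =>
    cases hs with
    | isotopy K K' h => exact h.exists_twistRelated κ
    | diffeomorphism K K' Φ hΦ h => exact Knot.exists_twistRelated_of_admits hΦ h
    | destabilization K K' h => exact ⟨0, h.twistRelated⟩
  | refl p => exact ⟨0, .refl p.2⟩
  | symm p q _ ih => obtain ⟨u, hu⟩ := ih; exact ⟨_, hu.symm⟩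
  | trans p q r _ _ ih ih' =>
    obtain ⟨u, hu⟩ := ih
    obtain ⟨v, hv⟩ := ih'
    exact ⟨_, hu.trans hv⟩

/-- Lifts of equivalent knots along the same covering are equivalent. -/
theorem KnotEquivalent.lift {κ : EquivalenceKind} {K L : Knot S} {K' L' : Knot S'} {m : ℤ}
    (hm : m ≠ 0) (h : KnotEquivalent κ K K') (hL : K.IsLiftAlong m L) (hL' : K'.IsLiftAlong m L') :
    KnotEquivalent κ L L' := by
  obtain ⟨u, hu⟩ := h.exists_twistRelated
  have hM := K'.isLiftAlong_root hm _ (L.continuous_twist u m) (hL.twist_zpow hm hu.1)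
  exact Relation.EqvGen.trans _ _ _ (hu.2 m hm L _ hL hM fun t => rfl)
    ((hM.isotopic hm hL').equivalent κ)

theorem KnotEquivalent.hasDegree {κ : EquivalenceKind} {K : Knot S} {K' : Knot S'} {k : ℤ}
    (h : KnotEquivalent κ K K') (hk : K.HasDegree k) : K'.HasDegree k := by
  obtain ⟨u, hu⟩ := h.exists_twistRelated
  exact hk.of_height_eq u hu.1

end

/-! ### Heights and labels along a diagram -/

section

open Set Filter Topology unitInterval

/-! ### The height `turn` -/

theorem turn_nonneg (z : Circle) : 0 ≤ turn z := Int.fract_nonneg _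

theorem turn_lt_one (z : Circle) : turn z < 1 := Int.fract_lt_one _

theorem exp_add_int (x : ℝ) (n : ℤ) :
    Circle.exp (2 * Real.pi * (x + n)) = Circle.exp (2 * Real.pi * x) := by
  rw [mul_add, Circle.exp_add, Circle.exp_two_pi_mul_int, mul_one]

theorem exp_turn (z : Circle) : Circle.exp (2 * Real.pi * turn z) = z := by
  rw [turn, Int.fract, sub_eq_add_neg, ← Int.cast_neg, exp_add_int, mul_div_cancel₀ _ (by positivity),
    Circle.exp_arg]

theorem turn_exp (r : ℝ) : turn (Circle.exp (2 * Real.pi * r)) = Int.fract r := by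
  obtain ⟨n, hn⟩ := Circle.exp_eq_exp.mp (exp_turn (Circle.exp (2 * Real.pi * r)))
  have h2 : turn (Circle.exp (2 * Real.pi * r)) = r + n :=
    mul_left_cancel₀ (Real.two_pi_pos.ne') (by rw [hn]; ring)
  rw [← Int.fract_eq_self.mpr ⟨turn_nonneg _, turn_lt_one _⟩, h2, Int.fract_add_intCast]

theorem turn_eq_zero {z : Circle} : turn z = 0 ↔ z = 1 := by
  constructor
  · intro h; rw [← exp_turn z, h]; simp
  · rintro rfl; simp [turn]

/-- Away from `1`, `turn w` is `1 / 2` plus the argument of `-w` in turns, and the branch cut of the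
latter is met only at `w = 1`. -/
theorem continuousAt_turn {z : Circle} (hz : z ≠ 1) : ContinuousAt turn z := by
  have hne (w : Circle) (hw : w ≠ 1) : Complex.arg ((-w : Circle) : ℂ) ≠ Real.pi := by
    intro h
    apply hw
    have h1 := Circle.exp_arg (-w)
    rw [h] at h1
    have h2 : -w = -1 := by
      rw [← h1]; ext; simp [Circle.coe_exp]
    exact neg_injective h2
  have key (w : Circle) (hw : w ≠ 1) :
      turn w = 1 / 2 + Complex.arg ((-w : Circle) : ℂ) / (2 * Real.pi) := by
    have h1 : Circle.exp (2 * Real.pi * (1 / 2 + Complex.arg ((-w : Circle) : ℂ) / (2 * Real.pi)))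
        = w := by
      have : 2 * Real.pi * (1 / 2 + Complex.arg ((-w : Circle) : ℂ) / (2 * Real.pi)) =
          Real.pi + Complex.arg ((-w : Circle) : ℂ) := by field_simp
      rw [this, Circle.exp_add, Circle.exp_arg]
      ext; simp [Circle.coe_exp]
    conv_lhs => rw [← h1]
    rw [turn_exp, Int.fract_eq_self]
    have h2 := Complex.neg_pi_lt_arg ((-w : Circle) : ℂ)
    have h3 := lt_of_le_of_ne (Complex.arg_le_pi ((-w : Circle) : ℂ)) (hne w hw)
    have h4 : -(1 / 2) < Complex.arg ((-w : Circle) : ℂ) / (2 * Real.pi) := by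
      rw [lt_div_iff₀ Real.two_pi_pos]; linarith
    have h5 : Complex.arg ((-w : Circle) : ℂ) / (2 * Real.pi) < 1 / 2 := by
      rw [div_lt_iff₀ Real.two_pi_pos]; linarith
    constructor <;> linarith
  have hc : ContinuousAt
      (fun w : Circle => 1 / 2 + Complex.arg ((-w : Circle) : ℂ) / (2 * Real.pi)) z := by
    refine continuousAt_const.add (ContinuousAt.div_const ?_ _)
    refine ContinuousAt.comp (f := fun w : Circle => ((-w : Circle) : ℂ)) (Complex.continuousAt_arg ?_)
      ?_
    · rw [Complex.mem_slitPlane_iff_arg]; exact ⟨hne z hz, by simp⟩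
    · simp only [Circle.coe_neg]; fun_prop
  refine hc.congr ?_
  filter_upwards [isOpen_ne.mem_nhds hz] with w hw
  exact (key w hw).symm

theorem turn_of_im_nonneg {z : Circle} (h : 0 ≤ (z : ℂ).im) :
    turn z = Complex.arg z / (2 * Real.pi) := by
  rw [turn, Int.fract_eq_self]
  have := Complex.arg_le_pi (z : ℂ)
  refine ⟨div_nonneg (Complex.arg_nonneg_iff.mpr h) Real.two_pi_pos.le, ?_⟩
  rw [div_lt_one Real.two_pi_pos]; linarith [Real.pi_pos]

theorem turn_of_im_neg {z : Circle} (h : (z : ℂ).im < 0) :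
    turn z = Complex.arg z / (2 * Real.pi) + 1 := by
  rw [turn, ← Int.fract_add_one, Int.fract_eq_self]
  have h1 := Complex.neg_pi_lt_arg (z : ℂ)
  have h2 := Complex.arg_neg_iff.mpr h
  have h3 : -1 < Complex.arg (z : ℂ) / (2 * Real.pi) := by
    rw [lt_div_iff₀ Real.two_pi_pos]; linarith [Real.pi_pos]
  have h4 : Complex.arg (z : ℂ) / (2 * Real.pi) < 0 := div_neg_of_neg_of_pos h2 Real.two_pi_pos
  constructor <;> linarith

/-! ### Labels along a diagram -/

/-- The strict inequality makes labels left-continuous: a vertex counts only after it has been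
passed. -/
theorem eventually_filter_lt_eq_left {α : Type*} (s : Finset α) (x : α → ℝ) (r₀ : ℝ) :
    ∀ᶠ r in 𝓝 r₀, r ≤ r₀ → (s.filter fun v => x v < r) = s.filter fun v => x v < r₀ := by
  have : ∀ v ∈ s, ∀ᶠ r in 𝓝 r₀, r ≤ r₀ → (x v < r ↔ x v < r₀) := by
    intro v _
    rcases lt_or_ge (x v) r₀ with h | h
    · filter_upwards [lt_mem_nhds h] with r hr _
      exact iff_of_true hr h
    · exact Eventually.of_forall fun r hr => iff_of_false (by linarith) (by linarith)
  filter_upwards [(Finset.eventually_all s).mpr this] with r hr hle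
  exact Finset.filter_congr fun v hv => hr v hv hle

theorem eventually_filter_lt_eq_right {α : Type*} (s : Finset α) (x : α → ℝ) (r₀ : ℝ) :
    ∀ᶠ r in 𝓝 r₀, r₀ < r → (s.filter fun v => x v < r) = s.filter fun v => x v ≤ r₀ := by
  have : ∀ v ∈ s, ∀ᶠ r in 𝓝 r₀, r₀ < r → (x v < r ↔ x v ≤ r₀) := by
    intro v _
    rcases le_or_gt (x v) r₀ with h | h
    · exact Eventually.of_forall fun r hr => iff_of_true (by linarith) h
    · filter_upwards [gt_mem_nhds h] with r hr _
      exact iff_of_false (by linarith) (by linarith)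
  filter_upwards [(Finset.eventually_all s).mpr this] with r hr hle
  exact Finset.filter_congr fun v hv => hr v hv hle

namespace Diagram

variable {S : ClosedSurface.{u}}

/-- The point reached from `b` after the fraction `r` of a turn. -/
noncomputable def walk (b : Circle) (r : ℝ) : Circle := b * Circle.exp (2 * Real.pi * r)

theorem continuous_walk (b : Circle) : Continuous (walk b) := by unfold walk; fun_prop

theorem continuous_height_walk (K : Knot S) (b : Circle) : Continuous fun r => (K (walk b r)).2 :=
  K.continuous_height.comp (continuous_walk b)

theorem walk_turn (b t : Circle) : walk b (turn (t / b)) = t := by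
  rw [walk, exp_turn, mul_div_cancel]

theorem turn_walk_div (b : Circle) {r : ℝ} (h₀ : 0 ≤ r) (h₁ : r < 1) :
    turn (walk b r / b) = r := by
  rw [walk, mul_div_cancel_left, turn_exp, Int.fract_eq_self.mpr ⟨h₀, h₁⟩]

open Classical in
theorem card_filter_turn_le (s : Finset Circle) (b : Circle) {r : ℝ} (h₀ : 0 ≤ r) (h₁ : r < 1) :
    (s.filter fun v => turn (v / b) ≤ r).card =
      (s.filter fun v => turn (v / b) < r).card + if walk b r ∈ s then 1 else 0 := by
  have : (s.filter fun v => turn (v / b) ≤ r) =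
      (s.filter fun v => turn (v / b) < r) ∪ s.filter fun v => walk b r = v := by
    ext v
    simp only [Finset.mem_filter, Finset.mem_union, ← and_or_left]
    refine and_congr_right fun _ => ?_
    rw [le_iff_lt_or_eq]
    refine or_congr_right ⟨fun h => by rw [← h, walk_turn], ?_⟩
    rintro rfl; exact turn_walk_div b h₀ h₁
  rw [this, Finset.card_union_of_disjoint, Finset.filter_eq]
  · split_ifs <;> simp
  · rw [Finset.disjoint_filter]
    rintro v - h rfl
    rw [turn_walk_div b h₀ h₁] at h
    exact lt_irrefl _ h

open Classical in
/-- The label on arrival after the fraction `r` of a turn from `b`. -/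
noncomputable def labelAt (D : Diagram S) (b : Circle) (r : ℝ) : ℤ :=
  ((D.up.filter fun v => turn (v / b) < r).card : ℤ) -
    ((D.down.filter fun v => turn (v / b) < r).card : ℤ)

theorem labelAt_turn (D : Diagram S) (b t : Circle) : D.labelAt b (turn (t / b)) = D.label b t := rfl

theorem labelAt_zero (D : Diagram S) (b : Circle) : D.labelAt b 0 = 0 := by
  simp [labelAt, (turn_nonneg _).not_gt]

theorem labelAt_one (D : Diagram S) (b : Circle) : D.labelAt b 1 = D.degree := by
  simp [labelAt, turn_lt_one, degree]

theorem eventually_labelAt_left (D : Diagram S) (b : Circle) (r₀ : ℝ) :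
    ∀ᶠ r in 𝓝 r₀, r ≤ r₀ → D.labelAt b r = D.labelAt b r₀ := by
  classical
  filter_upwards [eventually_filter_lt_eq_left D.up (fun v => turn (v / b)) r₀,
    eventually_filter_lt_eq_left D.down (fun v => turn (v / b)) r₀] with r h h' hr
  unfold labelAt
  rw [← h hr, ← h' hr]

open Classical in
theorem eventually_labelAt_right (D : Diagram S) (b : Circle) {r₀ : ℝ} (h₀ : 0 ≤ r₀)
    (h₁ : r₀ < 1) : ∀ᶠ r in 𝓝 r₀, r₀ < r → D.labelAt b r = D.labelAt b r₀ +
      ((if walk b r₀ ∈ D.up then 1 else 0) - if walk b r₀ ∈ D.down then 1 else 0) := by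
  filter_upwards [eventually_filter_lt_eq_right D.up (fun v => turn (v / b)) r₀,
    eventually_filter_lt_eq_right D.down (fun v => turn (v / b)) r₀] with r h h' hr
  unfold labelAt
  rw [h hr, h' hr, card_filter_turn_le _ _ h₀ h₁, card_filter_turn_le _ _ h₀ h₁]
  push_cast
  ring

open Classical in
/-- The height of `K` on arrival at `t`: it is `1` where `K` passes upwards through the level at which
`S × S¹` is cut open. -/
noncomputable def arrivalHeight (D : Diagram S) (K : Knot S) (t : Circle) : ℝ :=
  if t ∈ D.up then 1 else turn (K t).2

theorem arrivalHeight_of_mem {D : Diagram S} {t : Circle} (h : t ∈ D.up) (K : Knot S) :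
    D.arrivalHeight K t = 1 := if_pos h

theorem arrivalHeight_of_notMem {D : Diagram S} {t : Circle} (h : t ∉ D.up) (K : Knot S) :
    D.arrivalHeight K t = turn (K t).2 := if_neg h

namespace Presents

variable {D : Diagram S} {K : Knot S} (hP : D.Presents K)
include hP

theorem fst_eq (t : Circle) : (K t).1 = D.curve t := hP.1 t

theorem snd_eq_one_iff (t : Circle) : (K t).2 = 1 ↔ t ∈ D.up ∨ t ∈ D.down := hP.2.1 t

theorem exp_arrivalHeight (t : Circle) :
    Circle.exp (2 * Real.pi * D.arrivalHeight K t) = (K t).2 := by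
  by_cases h : t ∈ D.up
  · rw [arrivalHeight_of_mem h, (hP.snd_eq_one_iff t).mpr (.inl h)]; simp
  · rw [arrivalHeight_of_notMem h, exp_turn]

theorem eventually_sign_up {b : Circle} {r₀ : ℝ} (h : walk b r₀ ∈ D.up) :
    ∀ᶠ r in 𝓝 r₀, SignType.sign ((K (walk b r)).2 : ℂ).im = SignType.sign (r - r₀) := by
  have h1 := eventually_nhdsWithin_sign_eq_of_deriv_pos (hP.2.2.1 _ h)
    (by simp [(hP.snd_eq_one_iff _).mpr (.inl h)])
  have hc : Tendsto (fun r => 2 * Real.pi * (r - r₀)) (𝓝 r₀) (𝓝 0) :=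
    Continuous.tendsto' (by fun_prop) _ _ (by simp)
  filter_upwards [hc.eventually h1] with r hr
  have e : walk b r₀ * Circle.exp (2 * Real.pi * (r - r₀)) = walk b r := by
    rw [walk, walk, mul_assoc, ← Circle.exp_add]; congr 2; ring
  rw [e, sub_zero, sign_mul, sign_pos Real.two_pi_pos, one_mul] at hr
  exact hr

theorem eventually_sign_down {b : Circle} {r₀ : ℝ} (h : walk b r₀ ∈ D.down) :
    ∀ᶠ r in 𝓝 r₀, SignType.sign ((K (walk b r)).2 : ℂ).im = SignType.sign (r₀ - r) := by
  have h1 := eventually_nhdsWithin_sign_eq_of_deriv_neg (hP.2.2.2.1 _ h)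
    (by simp [(hP.snd_eq_one_iff _).mpr (.inr h)])
  have hc : Tendsto (fun r => 2 * Real.pi * (r - r₀)) (𝓝 r₀) (𝓝 0) :=
    Continuous.tendsto' (by fun_prop) _ _ (by simp)
  filter_upwards [hc.eventually h1] with r hr
  have e : walk b r₀ * Circle.exp (2 * Real.pi * (r - r₀)) = walk b r := by
    rw [walk, walk, mul_assoc, ← Circle.exp_add]; congr 2; ring
  rw [e, zero_sub, ← mul_neg, neg_sub, sign_mul, sign_pos Real.two_pi_pos, one_mul] at hr
  exact hr

theorem continuousAt_arg_walk {b : Circle} {r₀ : ℝ} (h : walk b r₀ ∈ D.up ∨ walk b r₀ ∈ D.down) :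
    ContinuousAt (fun r => Complex.arg ((K (walk b r)).2 : ℂ) / (2 * Real.pi)) r₀ := by
  refine ContinuousAt.div_const (ContinuousAt.comp (f := fun r => ((K (walk b r)).2 : ℂ))
    (Complex.continuousAt_arg ?_)
    (Continuous.subtype_val (continuous_height_walk K b)).continuousAt) _
  rw [(hP.snd_eq_one_iff _).mpr h]; simp

/-- Height and label together vary continuously along the knot. -/
theorem continuousOn_arrivalHeight_add_labelAt (b : Circle) :
    ContinuousOn (fun r => D.arrivalHeight K (walk b r) + D.labelAt b r) (Icc 0 1) := by
  classical
  intro r₀ hr₀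
  have hleft := D.eventually_labelAt_left b r₀
  have hright : ∀ᶠ r in 𝓝[Icc 0 1] r₀, r₀ < r → D.labelAt b r = D.labelAt b r₀ +
      ((if walk b r₀ ∈ D.up then 1 else 0) - if walk b r₀ ∈ D.down then 1 else 0) := by
    -- At the end `r₀ = 1` of the walk nothing lies to the right.
    rcases hr₀.2.lt_or_eq with h | h
    · exact (D.eventually_labelAt_right b hr₀.1 h).filter_mono nhdsWithin_le_nhds
    · filter_upwards [self_mem_nhdsWithin] with r hr hlt
      exact absurd hr.2 (by linarith)
  have hnot (v : Circle) (hv : (K v).2 ≠ 1) : v ∉ D.up := fun h =>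
    hv ((hP.snd_eq_one_iff v).mpr (.inl h))
  by_cases hup : walk b r₀ ∈ D.up
  -- At an upward vertex `turn` drops from near `1` to near `0` while the label rises by one. On
  -- both sides the sum is the argument in turns plus the old label plus `1`; the value `1` of
  -- `arrivalHeight` fits the vertex itself.
  · have hdown : walk b r₀ ∉ D.down := Finset.disjoint_left.mp D.disjoint hup
    have hc := (hP.continuousAt_arg_walk (.inl hup)).add
      (continuousAt_const (y := (D.labelAt b r₀ + 1 : ℝ)))
    refine hc.continuousWithinAt.congr_of_eventuallyEq_of_mem ?_ hr₀
    filter_upwards [hleft.filter_mono nhdsWithin_le_nhds, hright,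
      (hP.eventually_sign_up hup).filter_mono nhdsWithin_le_nhds] with r hl hr hs
    rcases lt_trichotomy r r₀ with h | rfl | h
    · rw [sign_neg (by linarith : r - r₀ < 0), sign_eq_neg_one_iff] at hs
      have : (K (walk b r)).2 ≠ 1 := by rintro e; rw [e] at hs; simp at hs
      simp only [arrivalHeight_of_notMem (hnot _ this), turn_of_im_neg hs, hl h.le, Pi.add_apply]
      ring
    · simp only [arrivalHeight_of_mem hup, (hP.snd_eq_one_iff _).mpr (.inl hup), Pi.add_apply]
      simp; ring
    · rw [sign_pos (by linarith : 0 < r - r₀), sign_eq_one_iff] at hs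
      have : (K (walk b r)).2 ≠ 1 := by rintro e; rw [e] at hs; simp at hs
      simp only [arrivalHeight_of_notMem (hnot _ this), turn_of_im_nonneg hs.le, hr h, Pi.add_apply,
        hup, hdown]
      simp
  by_cases hdown : walk b r₀ ∈ D.down
  -- At a downward vertex `turn` jumps from near `0` to near `1` while the label falls by one. The
  -- value `turn = 0` at the vertex already agrees with the arrival side.
  · have hc := (hP.continuousAt_arg_walk (.inr hdown)).add
      (continuousAt_const (y := (D.labelAt b r₀ : ℝ)))
    refine hc.continuousWithinAt.congr_of_eventuallyEq_of_mem ?_ hr₀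
    filter_upwards [hleft.filter_mono nhdsWithin_le_nhds, hright,
      (hP.eventually_sign_down hdown).filter_mono nhdsWithin_le_nhds] with r hl hr hs
    rcases lt_trichotomy r r₀ with h | rfl | h
    · rw [sign_pos (by linarith : 0 < r₀ - r), sign_eq_one_iff] at hs
      have : (K (walk b r)).2 ≠ 1 := by rintro e; rw [e] at hs; simp at hs
      simp only [arrivalHeight_of_notMem (hnot _ this), turn_of_im_nonneg hs.le, hl h.le,
        Pi.add_apply]
    · have h1 := (hP.snd_eq_one_iff _).mpr (.inr hdown)
      simp only [arrivalHeight_of_notMem hup, h1, turn_eq_zero.mpr, Pi.add_apply]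
      simp
    · rw [sign_neg (by linarith : r₀ - r < 0), sign_eq_neg_one_iff] at hs
      have : (K (walk b r)).2 ≠ 1 := by rintro e; rw [e] at hs; simp at hs
      simp only [arrivalHeight_of_notMem (hnot _ this), turn_of_im_neg hs, hr h, Pi.add_apply,
        hup, hdown]
      simp; ring
  · have h1 : (K (walk b r₀)).2 ≠ 1 := fun h => ((hP.snd_eq_one_iff _).mp h).elim hup hdown
    have hc : ContinuousAt (fun r => turn (K (walk b r)).2 + (D.labelAt b r₀ : ℝ)) r₀ :=
      (ContinuousAt.comp (f := fun r => (K (walk b r)).2) (continuousAt_turn h1)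
        (continuous_height_walk K b).continuousAt).add continuousAt_const
    refine hc.continuousWithinAt.congr_of_eventuallyEq_of_mem ?_ hr₀
    have hne := (continuous_height_walk K b).continuousAt.eventually_ne h1
    filter_upwards [hleft.filter_mono nhdsWithin_le_nhds, hright,
      hne.filter_mono nhdsWithin_le_nhds] with r hl hr hs
    rw [arrivalHeight_of_notMem (hnot _ hs)]
    rcases le_or_gt r r₀ with h | h
    · rw [hl h]
    · rw [hr h]; simp [hup, hdown]

theorem exp_arrivalHeight_add_labelAt (b : Circle) (r : ℝ) :
    Circle.exp (2 * Real.pi * (D.arrivalHeight K (walk b r) + D.labelAt b r)) =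
      (K (walk b r)).2 := by
  rw [exp_add_int, hP.exp_arrivalHeight]

end Presents

end Diagram

end

/-! ### Knots with a common diagram, and the lifted diagram -/

section

open Set Filter Topology unitInterval

namespace Diagram

variable {S : ClosedSurface.{u}}

theorem arrivalHeight_of_isDouble {D : Diagram S} {s t : Circle} (h : IsDouble D.curve s t)
    (K : Knot S) : D.arrivalHeight K s = turn (K s).2 :=
  arrivalHeight_of_notMem (fun hs => D.vertex_simple s (.inl hs) t h) K

namespace Presents

variable {D : Diagram S} {K K' : Knot S} (hP : D.Presents K)
include hP

/-- Height plus label is a real lift of the height along one full walk. The arrival heights at its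
two ends agree, so the climb is that of the label, from `0` to the degree. -/
theorem hasDegree : K.HasDegree D.degree := by
  obtain ⟨h, hh, e⟩ := Circle.exists_real_lift (continuous_height_walk K 1)
  have := Circle.sub_eq_sub_of_exp_eq (X := Icc (0 : ℝ) 1) (g := fun r => h r)
    (h := fun r => 2 * Real.pi * (D.arrivalHeight K (walk 1 r) + D.labelAt 1 r)) (by fun_prop)
    (continuous_const.mul (continuousOn_iff_continuous_domRestrict.mp
      (hP.continuousOn_arrivalHeight_add_labelAt 1)))
    (fun r => by rw [← e, hP.exp_arrivalHeight_add_labelAt]) 1 0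
  have hw : walk 1 1 = walk 1 0 := by simp [walk]
  simp only [Icc.coe_one, Icc.coe_zero, hw, labelAt_one, labelAt_zero] at this
  refine ⟨fun r => h r / (2 * Real.pi), by fun_prop, fun r => ?_, ?_⟩
  · rw [mul_div_cancel₀ _ Real.two_pi_pos.ne', ← e, walk, one_mul]
  · have h2 : h 1 - h 0 = 2 * Real.pi * D.degree := by push_cast at this; linarith
    beta_reduce
    rw [← sub_div, h2]; field_simp

/-- Between two knots with the same diagram the height changes by a continuous angle. -/
theorem exists_angle (hP' : D.Presents K') : ∃ g : Circle → ℝ, Continuous g ∧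
    ∀ t, g t = 2 * Real.pi * (D.arrivalHeight K' t - D.arrivalHeight K t) := by
  obtain ⟨g, hg⟩ := Knot.hasDegree_iff.mp hP.hasDegree
  obtain ⟨g', hg'⟩ := Knot.hasDegree_iff.mp hP'.hasDegree
  have hc (b : Circle) := continuousOn_iff_continuous_domRestrict.mp
    (hP.continuousOn_arrivalHeight_add_labelAt b)
  have hc' (b : Circle) := continuousOn_iff_continuous_domRestrict.mp
    (hP'.continuousOn_arrivalHeight_add_labelAt b)
  -- Both sides exponentiate to the same product, since the two knots have the same degree. The
  -- labels cancel in the difference, so the difference of arrival heights is continuous although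
  -- neither height need be.
  have key := Circle.sub_eq_sub_of_exp_eq (X := Icc (0 : ℝ) 1)
    (g := fun r => g' (walk 1 r) +
      2 * Real.pi * (D.arrivalHeight K (walk 1 r) + D.labelAt 1 r))
    (h := fun r => g (walk 1 r) +
      2 * Real.pi * (D.arrivalHeight K' (walk 1 r) + D.labelAt 1 r))
    ((g'.continuous.comp ((continuous_walk 1).comp continuous_subtype_val)).add
      (continuous_const.mul (hc 1)))
    ((g.continuous.comp ((continuous_walk 1).comp continuous_subtype_val)).add
      (continuous_const.mul (hc' 1)))
    (fun r => by
      rw [Circle.exp_add, Circle.exp_add, hP.exp_arrivalHeight_add_labelAt,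
        hP'.exp_arrivalHeight_add_labelAt, hg, hg']
      exact mul_left_comm _ _ _ |>.trans (by ac_rfl))
  refine ⟨fun t => (g' t - g t) - (g' (walk 1 0) + 2 * Real.pi * (D.arrivalHeight K (walk 1 0)) -
    (g (walk 1 0) + 2 * Real.pi * (D.arrivalHeight K' (walk 1 0)))), by fun_prop, fun t => ?_⟩
  have := key ⟨turn (t / 1), turn_nonneg _, (turn_lt_one _).le⟩ 0
  simp only [walk_turn, Icc.coe_zero] at this
  linarith

/-- Interpolating between the heights of two knots with the same diagram keeps over-strands above
under-strands, so that the strands never meet. -/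
theorem injective_interpolation (hP' : D.Presents K') {c : ℝ} (h₀ : 0 ≤ c) (h₁ : c ≤ 1) :
    Function.Injective fun t => (D.curve t, Circle.exp (2 * Real.pi *
      (D.arrivalHeight K t + c * (D.arrivalHeight K' t - D.arrivalHeight K t)))) := by
  have key (s t : Circle) (h : D.above s t) :
      Circle.exp (2 * Real.pi *
        (D.arrivalHeight K s + c * (D.arrivalHeight K' s - D.arrivalHeight K s))) ≠
      Circle.exp (2 * Real.pi *
        (D.arrivalHeight K t + c * (D.arrivalHeight K' t - D.arrivalHeight K t))) := by
    have hd := D.above_double s t h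
    have hd' : IsDouble D.curve t s := ⟨hd.1.symm, hd.2.symm⟩
    have a := hP.2.2.2.2 s t h
    have a' := hP'.2.2.2.2 s t h
    -- Interpolated heights at a crossing stay in `[0, 1)`, so equality on the circle is equality of
    -- real heights, which the common crossing order excludes.
    have range (x y : ℝ) (hx : 0 ≤ x) (hx' : x < 1) (hy : 0 ≤ y) (hy' : y < 1) :
        0 ≤ x + c * (y - x) ∧ x + c * (y - x) < 1 := by
      constructor
      · nlinarith [mul_nonneg (sub_nonneg.mpr h₁) hx, mul_nonneg h₀ hy]
      · rcases h₁.lt_or_eq with h | rfl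
        · nlinarith [mul_pos (sub_pos.mpr h) (sub_pos.mpr hx'),
            mul_nonneg h₀ (sub_nonneg.mpr hy'.le)]
        · linarith
    rw [arrivalHeight_of_isDouble hd K, arrivalHeight_of_isDouble hd' K,
      arrivalHeight_of_isDouble hd K', arrivalHeight_of_isDouble hd' K']
    intro e
    have e' := congrArg turn e
    rw [turn_exp, turn_exp,
      Int.fract_eq_self.mpr (range _ _ (turn_nonneg _) (turn_lt_one _) (turn_nonneg _)
        (turn_lt_one _)),
      Int.fract_eq_self.mpr (range _ _ (turn_nonneg _) (turn_lt_one _) (turn_nonneg _)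
        (turn_lt_one _))] at e'
    rcases h₁.lt_or_eq with h | rfl
    · nlinarith [mul_pos (sub_pos.mpr h) (sub_pos.mpr a), mul_nonneg h₀ (sub_nonneg.mpr a'.le)]
    · linarith
  intro s t hst
  by_contra hne
  have hd : IsDouble D.curve s t := ⟨hne, congrArg Prod.fst hst⟩
  by_cases ha : D.above s t
  · exact key s t ha (congrArg Prod.snd hst)
  · have hd' : IsDouble D.curve t s := ⟨hd.1.symm, hd.2.symm⟩
    exact key t s ((D.above_iff t s hd').mpr ha) (congrArg Prod.snd hst).symm

/-- Knots with the same diagram are isotopic. -/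
theorem isotopic (hP' : D.Presents K') : K.Isotopic K' := by
  obtain ⟨g, hg, e⟩ := hP.exists_angle hP'
  have hexp (t : Circle) : Circle.exp (g t) = (K' t).2 / (K t).2 := by
    rw [e, mul_sub, Circle.exp_sub, hP.exp_arrivalHeight, hP'.exp_arrivalHeight]
  have hgs : ContMDiff (𝓡 1) 𝓘(ℝ, ℝ) ∞ g := Circle.contMDiff_of_exp hg (by
    simp only [hexp]
    exact Circle.contMDiff_div K'.contMDiff_height K.contMDiff_height)
  have hsm : ContMDiff (𝓘(ℝ, ℝ).prod (𝓡 1)) model3 ∞ fun p : ℝ × Circle =>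
      (D.curve p.2, (K p.2).2 * Circle.exp (Knot.clampedTime p.1 * g p.2)) := by
    refine (D.smooth.comp contMDiff_snd).prodMk (Circle.contMDiff_mul'
      (K.contMDiff_height.comp contMDiff_snd) (contMDiff_circleExp.comp ?_))
    exact (Knot.contDiff_clampedTime.contMDiff.comp contMDiff_fst).mul (hgs.comp contMDiff_snd)
  have hs (s : ℝ) : ContMDiff (𝓡 1) model3 ∞ fun t =>
      (D.curve t, (K t).2 * Circle.exp (Knot.clampedTime s * g t)) :=
    hsm.comp (contMDiff_const.prodMk contMDiff_id)
  refine ⟨fun s => ⟨fun t => (D.curve t, (K t).2 * Circle.exp (Knot.clampedTime s * g t)),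
    hs s, ?_, fun t => ?_⟩, hsm, ?_, ?_⟩
  · convert! hP.injective_interpolation hP' (Knot.clampedTime s).2.1 (Knot.clampedTime s).2.2
      using 3 with t
    rw [mul_add, Circle.exp_add, hP.exp_arrivalHeight, e]
    congr 2; ring
  · exact injective_mfderiv_of_comp (hs s) contMDiff_fst t (D.immersion t)
  · refine Knot.ext_apply fun t => Prod.ext (hP.fst_eq t).symm ?_
    change (K t).2 * Circle.exp (Knot.clampedTime 0 * g t) = _
    rw [Knot.clampedTime_zero]; simp
  · refine Knot.ext_apply fun t => Prod.ext (hP'.fst_eq t).symm ?_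
    change (K t).2 * Circle.exp (Knot.clampedTime 1 * g t) = _
    rw [Knot.clampedTime_one, Icc.coe_one, one_mul, hexp, mul_div_cancel]

/-- The lift of a knot which starts on layer `0` at `b`. -/
theorem exists_lift_height (b : Circle) (hk : D.degree ≠ 0) : ∃ L, K.IsLiftAlong |D.degree| L ∧
    ∀ t, (L t).2 = Circle.exp
      (2 * Real.pi * ((D.arrivalHeight K t + D.label b t) / (|D.degree| : ℤ))) := by
  have hm : |D.degree| ≠ 0 := abs_ne_zero.mpr hk
  have hd : K.HasDegree (|D.degree| * SignType.sign D.degree) := by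
    rw [abs_mul_sign]; exact hP.hasDegree
  obtain ⟨L, hL⟩ := Knot.exists_isLiftAlong hm hd
  -- The wanted height, as a function on the interval; that it closes up is not yet clear. It has a
  -- constant ratio to the height of the lift `L`, so rotating `L` by that ratio, a root of unity,
  -- gives the wanted lift.
  let v : ℝ → Circle := fun r => Circle.exp
    (2 * Real.pi * ((D.arrivalHeight K (walk b r) + D.labelAt b r) / (|D.degree| : ℤ)))
  have hv (r : ℝ) : v r ^ |D.degree| = (K (walk b r)).2 := by
    simp only [v]
    rw [← mul_div_assoc, Knot.exp_div_zpow hm, hP.exp_arrivalHeight_add_labelAt]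
  have hc := continuousOn_iff_continuous_domRestrict.mp
    (hP.continuousOn_arrivalHeight_add_labelAt b)
  have key := Circle.div_eq_div_of_zpow_eq (X := Icc (0 : ℝ) 1) hm (u := fun r => v r)
    (v := fun r => (L (walk b r)).2)
    (Circle.exp.continuous.comp (continuous_const.mul (hc.div_const _)))
    ((continuous_height_walk L b).comp continuous_subtype_val)
    (fun r => by rw [hv, hL.snd])
  refine ⟨L.rotate (v 0 / (L (walk b 0)).2), fun t => Prod.ext (hL.fst t) ?_, fun t => ?_⟩
  · change ((L t).2 * _) ^ _ = _
    rw [mul_zpow, div_zpow, hL.snd, hL.snd, hv, div_self', mul_one]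
  · have := key ⟨turn (t / b), turn_nonneg _, (turn_lt_one _).le⟩ 0
    simp only [walk_turn, Icc.coe_zero] at this
    change (L t).2 * _ = _
    rw [← this, mul_div_cancel]
    simp only [v, walk_turn, labelAt_turn]

end Presents

theorem layer_nonneg (D : Diagram S) (b t : Circle) (hk : D.degree ≠ 0) : 0 ≤ D.layer b t :=
  Int.emod_nonneg _ (abs_ne_zero.mpr hk)

theorem layer_lt (D : Diagram S) (b t : Circle) (hk : D.degree ≠ 0) :
    D.layer b t < |D.degree| :=
  Int.emod_lt_of_pos _ (abs_pos.mpr hk)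

/-- Label and layer differ by a multiple of `|D.degree|`, which amounts to whole turns. -/
theorem exp_layer (D : Diagram S) (b t : Circle) (hk : D.degree ≠ 0) (x : ℝ) :
    Circle.exp (2 * Real.pi * ((x + D.label b t) / (|D.degree| : ℤ))) =
      Circle.exp (2 * Real.pi * ((x + D.layer b t) / (|D.degree| : ℤ))) := by
  have hm : ((|D.degree| : ℤ) : ℝ) ≠ 0 := by exact_mod_cast abs_ne_zero.mpr hk
  rw [← exp_add_int ((x + D.layer b t) / (|D.degree| : ℤ)) (D.label b t / |D.degree|)]
  congr 2
  have : D.label b t = D.layer b t + |D.degree| * (D.label b t / |D.degree|) :=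
    (Int.emod_add_mul_ediv _ _).symm
  conv_lhs => rw [this]
  push_cast at hm ⊢
  field_simp
  ring

theorem hasDerivAt_coe_height (L : Knot S) (v : Circle) :
    ∃ z, HasDerivAt (fun r : ℝ => ((L (v * Circle.exp r)).2 : ℂ)) z 0 := by
  have h1 : ContMDiff 𝓘(ℝ, ℝ) 𝓘(ℝ, ℂ) ∞ fun r : ℝ => ((L (v * Circle.exp r)).2 : ℂ) :=
    Circle.contMDiff_coe.comp (L.contMDiff_height.comp
      (Circle.contMDiff_mul' contMDiff_const contMDiff_circleExp))
  exact ⟨_, ((contMDiff_iff_contDiff.mp h1).differentiable (by simp) 0).hasDerivAt⟩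

/-- The `n`-th power has derivative `n` at `1`. For `n > 0`, knot and lift thus cross the cutting
level in the same direction. -/
theorem deriv_im_height_of_isLiftAlong {K L : Knot S} {n : ℕ} (hL : K.IsLiftAlong n L)
    {v : Circle} (hv : (L v).2 = 1) :
    deriv (fun r : ℝ => ((K (v * Circle.exp r)).2 : ℂ).im) 0 =
      n * deriv (fun r : ℝ => ((L (v * Circle.exp r)).2 : ℂ).im) 0 := by
  obtain ⟨z, hz⟩ := hasDerivAt_coe_height L v
  have h1 := Complex.imCLM.hasFDerivAt.comp_hasDerivAt (0 : ℝ) hz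
  have h2 := Complex.imCLM.hasFDerivAt.comp_hasDerivAt (0 : ℝ) (hz.pow n)
  have e1 : deriv (fun r : ℝ => ((L (v * Circle.exp r)).2 : ℂ).im) 0 = z.im := h1.deriv
  have e2 : (fun r : ℝ => ((K (v * Circle.exp r)).2 : ℂ).im) =
      fun r : ℝ => (((L (v * Circle.exp r)).2 : ℂ) ^ n).im := by
    funext r
    rw [← hL.snd]; simp
  rw [e1, e2]
  refine h2.deriv.trans ?_
  simp [hv]

/-- Off the upward vertices the lift has height `(turn + layer) / |k|` in `[0, 1)`, so heights
compare first by layer and then as in `D`. The level `1` of the circle is met only with `turn = 0`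
on layer `0`, at downward vertices, or with arrival height `1` on layer `|k| - 1`, at upward ones.
-/
theorem Presents.lift {D : Diagram S} {K L : Knot S} (hP : D.Presents K) (b : Circle)
    (hk : D.degree ≠ 0) (hL : K.IsLiftAlong |D.degree| L)
    (e : ∀ t, (L t).2 = Circle.exp
      (2 * Real.pi * ((D.arrivalHeight K t + D.label b t) / (|D.degree| : ℤ)))) :
    (D.lift b).Presents L := by
  have hm : (0 : ℝ) < (|D.degree| : ℤ) := by exact_mod_cast abs_pos.mpr hk
  have hl0 (t : Circle) : (0 : ℝ) ≤ D.layer b t := by exact_mod_cast D.layer_nonneg b t hk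
  have hl1 (t : Circle) : (D.layer b t : ℝ) + 1 ≤ (|D.degree| : ℤ) := by
    exact_mod_cast D.layer_lt b t hk
  have hturn (t : Circle) (ht : t ∉ D.up) :
      turn (L t).2 = (turn (K t).2 + D.layer b t) / (|D.degree| : ℤ) := by
    rw [e, exp_layer _ _ _ hk, turn_exp, arrivalHeight_of_notMem ht, Int.fract_eq_self]
    have := turn_nonneg (K t).2
    have := turn_lt_one (K t).2
    refine ⟨div_nonneg (by linarith [hl0 t]) hm.le, ?_⟩
    rw [div_lt_one hm]; linarith [hl1 t]
  have hup (t : Circle) (ht : t ∈ D.up) : (L t).2 = 1 ↔ D.layer b t = |D.degree| - 1 := by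
    rw [e, exp_layer _ _ _ hk, arrivalHeight_of_mem ht]
    constructor
    · intro h
      have h2 := (turn_exp _).symm.trans (turn_eq_zero.mpr h)
      rw [Int.fract_eq_zero_iff] at h2
      obtain ⟨n, hn⟩ := h2
      rw [eq_div_iff hm.ne'] at hn
      have hn' : n * |D.degree| = 1 + D.layer b t := by exact_mod_cast hn
      have h3 := D.layer_nonneg b t hk
      have h4 := D.layer_lt b t hk
      -- Because `0 < 1 + layer ≤ |k|`, the only possible multiple of `|k|` is `|k|` itself.
      have : n = 1 := by
        have : 0 < n := by by_contra hcon; nlinarith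
        by_contra hne
        have : 2 ≤ n := by lia
        nlinarith
      rw [this] at hn'; lia
    · intro h
      have : (1 + (D.layer b t : ℝ)) / (|D.degree| : ℤ) = 1 := by
        rw [h, div_eq_one_iff_eq hm.ne']; push_cast; ring
      rw [this]; simp
  have hdown (t : Circle) (ht : t ∈ D.down) : (L t).2 = 1 ↔ D.layer b t = 0 := by
    have ht' : t ∉ D.up := Finset.disjoint_right.mp D.disjoint ht
    rw [← turn_eq_zero, hturn t ht', (hP.snd_eq_one_iff t).mpr (.inr ht), turn_eq_zero.mpr rfl,
      zero_add, div_eq_zero_iff, or_iff_left hm.ne']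
    exact_mod_cast Iff.rfl
  have hone (t : Circle) (h : (L t).2 = 1) : (K t).2 = 1 := by
    rw [← hL.snd, h, one_zpow]
  have hL' : K.IsLiftAlong (D.degree.natAbs : ℤ) L := by rwa [Int.natCast_natAbs]
  have hn : (0 : ℝ) < (D.degree.natAbs : ℝ) := by exact_mod_cast Int.natAbs_pos.mpr hk
  have hmem_up (t : Circle) : t ∈ (D.lift b).up ↔ t ∈ D.up ∧ D.layer b t = |D.degree| - 1 := by
    simp [Diagram.lift]
  have hmem_down (t : Circle) : t ∈ (D.lift b).down ↔ t ∈ D.down ∧ D.layer b t = 0 := by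
    simp [Diagram.lift]
  refine ⟨fun t => (hL.fst t).trans (hP.fst_eq t), fun t => ?_, fun v hv => ?_, fun v hv => ?_,
    fun s t hst => ?_⟩
  · rw [hmem_up, hmem_down]
    constructor
    · intro h
      exact ((hP.snd_eq_one_iff t).mp (hone t h)).imp (fun ht => ⟨ht, (hup t ht).mp h⟩)
        fun ht => ⟨ht, (hdown t ht).mp h⟩
    · rintro (⟨ht, h⟩ | ⟨ht, h⟩)
      exacts [(hup t ht).mpr h, (hdown t ht).mpr h]
  · obtain ⟨hv, h⟩ := (hmem_up v).mp hv
    have := hP.2.2.1 v hv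
    rw [deriv_im_height_of_isLiftAlong hL' ((hup v hv).mpr h)] at this
    exact (pos_iff_pos_of_mul_pos this).mp hn
  · obtain ⟨hv, h⟩ := (hmem_down v).mp hv
    have := hP.2.2.2.1 v hv
    rw [deriv_im_height_of_isLiftAlong hL' ((hdown v hv).mpr h)] at this
    exact (neg_iff_pos_of_mul_neg (mul_comm (D.degree.natAbs : ℝ) _ ▸ this)).mpr hn
  · obtain ⟨hd, h⟩ := hst
    rw [hturn s fun hs => D.vertex_simple s (.inl hs) t hd,
      hturn t fun ht => D.vertex_simple t (.inl ht) s ⟨hd.1.symm, hd.2.symm⟩]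
    refine div_lt_div_of_pos_right ?_ hm
    rcases h with h | ⟨h, ha⟩
    · have : (D.layer b t : ℝ) + 1 ≤ D.layer b s := by exact_mod_cast h
      linarith [turn_lt_one (K t).2, turn_nonneg (K s).2]
    · rw [h]
      linarith [hP.2.2.2.2 s t ha]

/-- Every knot with diagram `D` has a lift whose diagram is the lifted diagram. -/
theorem Presents.exists_lift {D : Diagram S} {K : Knot S} (hP : D.Presents K) (b : Circle)
    (hk : D.degree ≠ 0) : ∃ L, K.IsLiftAlong |D.degree| L ∧ (D.lift b).Presents L := by
  obtain ⟨L, hL, e⟩ := hP.exists_lift_height b hk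
  exact ⟨L, hL, hP.lift b hk hL e⟩

end Diagram

end

/-! ### The main theorem -/

theorem mainTheorem4 (κ : EquivalenceKind) {S S' : ClosedSurface.{u}}
    (D : Diagram S) (D' : Diagram S') (hk : D.degree ≠ 0) (h : D.Equivalent κ D') :
    -- the two diagrams have the same degree, which is the degree of the knots they present
    D'.degree = D.degree ∧
    (∀ K : Knot S, D.Presents K → K.HasDegree D.degree) ∧
    (∀ K' : Knot S', D'.Presents K' → K'.HasDegree D.degree) ∧
    -- the knots lift along the covering `p_m`, where `m` is the degree up to sign, and all their
    -- lifts are equivalent knots of degree `1`, or all are equivalent knots of degree `-1`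
    (∀ m : ℤ, m = D.degree ∨ m = -D.degree →
      ∃ d : ℤ, (d = 1 ∨ d = -1) ∧
        ∀ (K : Knot S) (K' : Knot S'), D.Presents K → D'.Presents K' →
          (∃ L : Knot S, K.IsLiftAlong m L) ∧ (∃ L' : Knot S', K'.IsLiftAlong m L') ∧
          ∀ (L : Knot S) (L' : Knot S'), K.IsLiftAlong m L → K'.IsLiftAlong m L' →
            L.HasDegree d ∧ L'.HasDegree d ∧ KnotEquivalent κ L L') ∧
    -- the lifted diagrams, drawn with any choice of the fixed points `b` and `b'`, are diagrams of
    -- lifts along the `|k|`-fold covering, and they are equivalent diagrams of degree `1` or `-1`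
    (∀ b b' : Circle,
      (∀ K : Knot S, D.Presents K →
        ∃ L : Knot S, K.IsLiftAlong |D.degree| L ∧ (D.lift b).Presents L) ∧
      (∀ K' : Knot S', D'.Presents K' →
        ∃ L' : Knot S', K'.IsLiftAlong |D.degree| L' ∧ (D'.lift b').Presents L') ∧
      (D.lift b).Equivalent κ (D'.lift b') ∧
      ∃ d : ℤ, (d = 1 ∨ d = -1) ∧
        ∀ (L : Knot S) (L' : Knot S'), (D.lift b).Presents L → (D'.lift b').Presents L' →
          L.HasDegree d ∧ L'.HasDegree d ∧ KnotEquivalent κ L L') := by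
  obtain ⟨K₀, K₀', hK₀, hK₀', h₀⟩ := h
  have hdeg : D'.degree = D.degree := hK₀'.hasDegree.unique (h₀.hasDegree hK₀.hasDegree)
  have hD' (K' : Knot S') (hK' : D'.Presents K') : K'.HasDegree D.degree := hdeg ▸ hK'.hasDegree
  have hequiv (K : Knot S) (K' : Knot S') (hK : D.Presents K) (hK' : D'.Presents K') :
      KnotEquivalent κ K K' :=
    Relation.EqvGen.trans _ _ _ ((hK.isotopic hK₀).equivalent κ)
      (Relation.EqvGen.trans _ _ _ h₀ ((hK₀'.isotopic hK').equivalent κ))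
  have hlifts (m : ℤ) (hm : m = D.degree ∨ m = -D.degree) : ∃ d : ℤ, (d = 1 ∨ d = -1) ∧
      ∀ (K : Knot S) (K' : Knot S'), D.Presents K → D'.Presents K' →
        (∃ L : Knot S, K.IsLiftAlong m L) ∧ (∃ L' : Knot S', K'.IsLiftAlong m L') ∧
        ∀ (L : Knot S) (L' : Knot S'), K.IsLiftAlong m L → K'.IsLiftAlong m L' →
          L.HasDegree d ∧ L'.HasDegree d ∧ KnotEquivalent κ L L' := by
    -- The degree of every lift is the quotient of the degree by `m`.
    obtain ⟨d, hd, hmd⟩ : ∃ d : ℤ, (d = 1 ∨ d = -1) ∧ D.degree = m * d := by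
      rcases hm with rfl | rfl
      exacts [⟨1, .inl rfl, by ring⟩, ⟨-1, .inr rfl, by ring⟩]
    have hm0 : m ≠ 0 := by rintro rfl; exact hk (by rw [hmd, zero_mul])
    refine ⟨d, hd, fun K K' hK hK' => ?_⟩
    have hdK : K.HasDegree (m * d) := hmd ▸ hK.hasDegree
    have hdK' : K'.HasDegree (m * d) := hmd ▸ hD' K' hK'
    exact ⟨Knot.exists_isLiftAlong hm0 hdK, Knot.exists_isLiftAlong hm0 hdK', fun L L' hL hL' =>
      ⟨hL.hasDegree hm0 hdK, hL'.hasDegree hm0 hdK', (hequiv K K' hK hK').lift hm0 hL hL'⟩⟩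
  refine ⟨hdeg, fun K hK => hK.hasDegree, hD', hlifts, fun b b' => ?_⟩
  have hl (K : Knot S) (hK : D.Presents K) := hK.exists_lift b hk
  have hl' (K' : Knot S') (hK' : D'.Presents K') :
      ∃ L', K'.IsLiftAlong |D.degree| L' ∧ (D'.lift b').Presents L' := by
    have := hK'.exists_lift b' (hdeg ▸ hk)
    rwa [hdeg] at this
  obtain ⟨L₀, hL₀, hPL₀⟩ := hl K₀ hK₀
  obtain ⟨L₀', hL₀', hPL₀'⟩ := hl' K₀' hK₀'
  obtain ⟨d, hd, H⟩ := hlifts |D.degree| (abs_choice _)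
  obtain ⟨hdL, hdL', hLL'⟩ := (H K₀ K₀' hK₀ hK₀').2.2 L₀ L₀' hL₀ hL₀'
  refine ⟨hl, hl', ⟨L₀, L₀', hPL₀, hPL₀', hLL'⟩, d, hd, fun L L' hL hL' => ?_⟩
  -- A knot with diagram `D.lift b` need not be given as a lift, but it is isotopic to the lift
  -- `L₀`, which has the same diagram.
  have hi := (hPL₀.isotopic hL).equivalent κ
  have hi' := (hPL₀'.isotopic hL').equivalent κ
  exact ⟨hi.hasDegree hdL, hi'.hasDegree hdL', Relation.EqvGen.trans _ _ _
    (Relation.EqvGen.symm _ _ hi) (Relation.EqvGen.trans _ _ _ hLL' hi')⟩
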